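/- **Setting.** Take a binary feedforward convolutional encoder with $k_c\ge 1$ input bits and $n_c$ output bits per branch and memory order $m$, of rate $R_c=k_c/n_c$. A *detour* is a trellis path that leaves the zero state and returns to it for the first time. The free distance $d_f$, assumed positive, is the least number of nonzero code bits on a detour. The transfer function is the power series $T(D,N)=\sum_{d}D^{w(d)}N^{b(d)}$ over all detours $d$, where $w(d)$ and $b(d)$ are the numbers of nonzero code bits and nonzero information bits of $d$. It and its termwise derivative $\partial T/\partial N$ take values in $[0,\infty]$. A data block of $H\ge1$ groups of $k_c$ bits, followed by $m$ zero groups, is encoded into $x_{ij}=\pm1$ ($1\le i\le n_c$, $1\le j\le H+m$). One receives $y_{ij}=\sqrt{E_c}\,\alpha_{ij}x_{ij}+n_{ij}$, with $E_c,N_0>0$. The $n_{ij}\sim\mathcal N(0,N_0/2)$ and $\alpha_{ij}$ are all independent, and $\alpha_{ij}$ is Rician with density $\frac{a}{\sigma^2}e^{-(a^2+s^2)/2\sigma^2}I_0(as/\sigma^2)$, $a\ge0$ ($s\ge0$, $\sigma>0$). Let $E_b=\frac{H+m}{H}\frac1{R_c}E_c$ and $\gamma=s^2/(2\sigma^2)$.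 **Decoder.** The receiver knows the $\alpha_{ij}$ and runs the Viterbi algorithm with path metric $\sum_{j\le t}\sum_i\alpha_{ij}x_{ij}y_{ij}$ at level $t$, with Yamamoto–Itoh flag $u\ge0$. Say that a path $x$ *beats* a path $x'$ at level $t$ if $$\sum_{j\le t}\sum_i\alpha_{ij}(x_{ij}-x'_{ij})y_{ij}\ \ge\ \frac{u}{d_f}\sqrt{\frac{N_0}{2}}\sum_{j\le t}\sum_i|x'_{ij}-x_{ij}|\,\alpha_{ij}^2 .$$ All paths have label $\mathcal C$ up to level $m$. At every node of a level $t\ge m+1$ the survivor keeps label $\mathcal C$ if it had it and beats the second best path entering the node; otherwise it is labelled $\mathcal X$. Retransmission is requested if all survivors at level $H+m$ are labelled $\mathcal X$. **Performance measures**, for a given transmitted block: * $P_e(u)$, at level $t$: the probability of a first-event error, i.e. that the transmitted path has survived at all levels before $t$ and is replaced at level $t$ by a survivor that merges with it and beats it. * $P_x(u)$, per branch, at level $t\ge m+1$: the probability that the transmitted path has survived at all levels before $t$ and that at its node at level $t$ the survivor does not beat the second best path (so that it is labelled $\mathcal X$). * $P_b(u)$: $\frac1{Hk_c}$ times the expected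 number of information bit errors on those detours of the decoded path from the transmitted path that beat the transmitted path, i.e. such that the path which follows the transmitted path up to the beginning of the detour and then the detour beats the transmitted path at the end of the detour. For $u=0$ these are all detours, and $P_b(0)$ is the bit error probability of the Viterbi decoder. **Definition of $\tilde D$.** With $Q(x)=\frac1{\sqrt{2\pi}}\int_x^\infty e^{-t^2/2}dt$, put $$\tilde D\Big(\tfrac{E_c}{N_0},v,\sigma,s\Big)=\frac{e^{-\gamma}}{\pi}\int_0^\pi\frac1{2A\sigma^2}\Big[1-\frac{B_\theta\sqrt{2\pi}}{\sqrt{2A}}\,e^{B_\theta^2/4A}\,Q\Big(\frac{B_\theta}{\sqrt{2A}}\Big)\Big]d\theta,$$ $$A=\tfrac12\Big(\sqrt{\tfrac{2E_c}{N_0}}+v\Big)^2+\tfrac1{2\sigma^2},\qquad B_\theta=-\frac{s\cos\theta}{\sigma^2}.$$ **Claim.** For every transmitted block and every level $t$, $$P_e(u)\le T(D,N)\Big|_{N=1,\;D=\tilde D(E_c/N_0,\,u/d_f,\,\sigma,\,s)},\qquad P_b(u)\le\frac{\partial T(D,N)}{\partial N}\Big|_{N=1,\;D=\tilde D(E_c/N_0,\,u/d_f,\,\sigma,\,s)},$$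 and if $u<d_f\sqrt{\frac{2E_b}{N_0}\cdot\frac{H}{H+m}\cdot R_c}$, then $$P_x(u)\le T(D,N)\Big|_{N=1,\;D=\tilde D(E_c/N_0,\,-u/d_f,\,\sigma,\,s)} ;$$ in this case the probability that retransmission of the whole block is requested is at most $H$ times this bound. -/

import Mathlib

open MeasureTheory ProbabilityTheory
open scoped ENNReal NNReal

noncomputable section

namespace ConvARQ

/-! ### Convolutional codes -/

/-- A block of `k` bits. -/
abbrev Bits (k : ℕ) : Type := Fin k → ZMod 2

/-- A (feedforward, binary) convolutional encoder with `kc` input bits and `nc` output bits per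
branch and memory order `m` (constraint length `kc * (m + 1)`), given by the coefficients
`G 0, …, G m` of its generator polynomial matrix. -/
abbrev ConvCode (kc nc m : ℕ) : Type := Fin (m + 1) → Matrix (Fin nc) (Fin kc) (ZMod 2)

/-- A trellis path, given by its input blocks; the block `p j` drives the branch from level `j` to
level `j + 1`. Every path starts in the zero state at level `0`. -/
abbrev TPath (kc : ℕ) : Type := ℕ → Bits kc

variable {kc nc m : ℕ}

/-- The content of the shift register at level `t`: its entry `i` is the input block that entered
`i + 1` branches ago (zero before the start). -/
def stateAt (m : ℕ) (p : TPath kc) (t : ℕ) : Fin m → Bits kc :=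
  fun i => if (i : ℕ) < t then p (t - 1 - i) else 0

/-- The `nc` code bits on the branch from level `j` to level `j + 1`. -/
def codeBits (G : ConvCode kc nc m) (p : TPath kc) (j : ℕ) : Bits nc :=
  ∑ l : Fin (m + 1), if (l : ℕ) ≤ j then (G l).mulVec (p (j - l)) else 0

/-- Antipodal modulation of the code bits: `0 ↦ 1`, `1 ↦ -1`. -/
def symbol (G : ConvCode kc nc m) (p : TPath kc) (j : ℕ) (i : Fin nc) : ℝ :=
  if codeBits G p j i = 0 then 1 else -1

/-- `p` is a data block of `H` input blocks, followed by zero (tail) blocks. -/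
def IsBlock (H : ℕ) (p : TPath kc) : Prop := ∀ j, H ≤ j → p j = 0

/-- The paths `p` and `q` are in the same state at level `s`, separate there, and are in the same
state again for the first time at level `t`. -/
def Detour (m : ℕ) (p q : TPath kc) (s t : ℕ) : Prop :=
  s < t ∧ stateAt m p s = stateAt m q s ∧ p s ≠ q s ∧
    (∀ τ, s < τ → τ < t → stateAt m p τ ≠ stateAt m q τ) ∧ stateAt m p t = stateAt m q t

/-- The paths which leave the zero state at level `0` and return to it for the first time at
level `L` (`d.1 = L`, and `d.2` is the path). -/
def ZeroDetours (kc m : ℕ) : Set (ℕ × TPath kc) :=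
  {d | Detour m d.2 0 0 d.1 ∧ ∀ j, d.1 ≤ j → d.2 j = 0}

/-- Number of nonzero code bits on a detour. -/
def outWeight (G : ConvCode kc nc m) (d : ℕ × TPath kc) : ℕ :=
  ∑ j ∈ Finset.range d.1, hammingNorm (codeBits G d.2 j)

/-- Number of nonzero information bits on a detour. -/
def inWeight (d : ℕ × TPath kc) : ℕ := ∑ j ∈ Finset.range d.1, hammingNorm (d.2 j)

/-- The free distance. -/
def freeDist (G : ConvCode kc nc m) : ℕ := sInf (outWeight G '' ZeroDetours kc m)

/-- The transfer function `T(D, N)`: the generating function of the detours from the zero state,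
the exponent of `D` being the number of nonzero code bits and that of `N` the number of nonzero
information bits. A series with nonnegative terms, valued in `[0, ∞]`. -/
def transfer (G : ConvCode kc nc m) (D N : ℝ≥0∞) : ℝ≥0∞ :=
  ∑' d : ZeroDetours kc m, D ^ outWeight G d * N ^ inWeight (d : ℕ × TPath kc)

/-- The partial derivative `∂T/∂N` of the power series `T(D, N)`. -/
def transferDN (G : ConvCode kc nc m) (D N : ℝ≥0∞) : ℝ≥0∞ :=
  ∑' d : ZeroDetours kc m,
    D ^ outWeight G d * ((inWeight (d : ℕ × TPath kc) : ℝ≥0∞) *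
      N ^ (inWeight (d : ℕ × TPath kc) - 1))

/-- Wherever the series `T(D, ·)` converges beyond `N = 1`, its formal partial derivative at
`N = 1` is the derivative of the real function `N ↦ T(D, N)`. -/
theorem hasDerivAt_transfer (G : ConvCode kc nc m) (D : ℝ≥0∞) {R : ℝ} (hR : 1 < R)
    (h : transfer G D (ENNReal.ofReal R) ≠ ∞) :
    transferDN G D 1 ≠ ∞ ∧
    HasDerivAt (fun N : ℝ => (transfer G D (ENNReal.ofReal N)).toReal)
      (transferDN G D 1).toReal 1 := by
  set a : ZeroDetours kc m → ℕ := fun d => outWeight G d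
  set b : ZeroDetours kc m → ℕ := fun d => inWeight (d : ℕ × TPath kc)
  have hterm : ∀ d, D ^ a d ≠ ∞ := by
    intro d hd
    have h1 := ENNReal.ne_top_of_tsum_ne_top h d
    apply h1
    change D ^ a d * ENNReal.ofReal R ^ b d = ∞
    rw [hd]
    exact ENNReal.top_mul (pow_ne_zero _ (by simp; linarith))
  set c : ZeroDetours kc m → ℝ := fun d => (D ^ a d).toReal
  have hc : ∀ d, 0 ≤ c d := fun d => ENNReal.toReal_nonneg
  have hcD : ∀ d, D ^ a d = ENNReal.ofReal (c d) := fun d => (ENNReal.ofReal_toReal (hterm d)).symm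
  have hT : ∀ N : ℝ, 0 ≤ N → (transfer G D (ENNReal.ofReal N)).toReal = ∑' d, c d * N ^ b d := by
    intro N hN
    unfold transfer
    rw [ENNReal.tsum_toReal_eq]
    · refine tsum_congr fun d => ?_
      rw [ENNReal.toReal_mul, ENNReal.toReal_pow, ENNReal.toReal_pow, ENNReal.toReal_ofReal hN]
      simp only [c, a, b, ENNReal.toReal_pow]
    · intro d
      exact ENNReal.mul_ne_top (hterm d) (ENNReal.pow_ne_top ENNReal.ofReal_ne_top)
  have hsR : Summable fun d => c d * R ^ b d := by
    have := ENNReal.summable_toReal h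
    refine this.congr fun d => ?_
    rw [ENNReal.toReal_mul, ENNReal.toReal_pow, ENNReal.toReal_pow,
      ENNReal.toReal_ofReal (by linarith)]
    simp only [c, a, b, ENNReal.toReal_pow]
  obtain ⟨r, hr1, hrR⟩ := exists_between hR
  have hbern : ∀ k : ℕ, (k : ℝ) * r ^ (k - 1) ≤ (R - r)⁻¹ * R ^ k := by
    intro k
    rw [inv_mul_eq_div, le_div_iff₀ (by linarith)]
    rcases Nat.eq_zero_or_pos k with rfl | hk
    · simp
    · have h2 := one_add_mul_le_pow (a := R / r - 1)
        (by have : 0 ≤ R / r := by positivity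
            linarith) k
      have hr0 : 0 < r := by linarith
      have h3 : (1 + (R / r - 1)) ^ k * r ^ k = R ^ k := by
        rw [← mul_pow]; congr 1; field_simp; ring
      have h4 : r ^ k = r ^ (k - 1) * r := by
        rw [← pow_succ]; congr 1; omega
      have h5 := mul_le_mul_of_nonneg_right h2 (by positivity : 0 ≤ r ^ k)
      rw [h3] at h5
      have h6 : (1 + (k : ℝ) * (R / r - 1)) * r ^ k =
          r ^ k + k * r ^ (k - 1) * (R - r) := by
        rw [h4]; field_simp
      have : 0 ≤ r ^ k := by positivity
      linarith
  have hsu : Summable fun d => c d * ((b d : ℝ) * r ^ (b d - 1)) := by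
    refine Summable.of_nonneg_of_le (fun d => ?_) (fun d => ?_) (hsR.mul_left (R - r)⁻¹)
    · have := hc d
      positivity
    · calc c d * ((b d : ℝ) * r ^ (b d - 1)) ≤ c d * ((R - r)⁻¹ * R ^ b d) :=
            mul_le_mul_of_nonneg_left (hbern _) (hc d)
        _ = (R - r)⁻¹ * (c d * R ^ b d) := by ring
  have hdts : ∀ d, c d * ((b d : ℝ) * (1 : ℝ) ^ (b d - 1)) ≤ c d * ((b d : ℝ) * r ^ (b d - 1)) := by
    intro d
    have := hc d
    gcongr
  have hs1 : Summable fun d => c d * ((b d : ℝ) * (1 : ℝ) ^ (b d - 1)) :=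
    Summable.of_nonneg_of_le (fun d => by have := hc d; positivity) hdts hsu
  have hDN : transferDN G D 1 = ENNReal.ofReal (∑' d, c d * ((b d : ℝ) * (1 : ℝ) ^ (b d - 1))) := by
    rw [ENNReal.ofReal_tsum_of_nonneg (fun d => by have := hc d; positivity) hs1]
    unfold transferDN
    refine tsum_congr fun d => ?_
    rw [ENNReal.ofReal_mul (hc d), ← hcD d, ENNReal.ofReal_mul (by positivity)]
    simp [a, b]
  refine ⟨by rw [hDN]; exact ENNReal.ofReal_ne_top, ?_⟩
  rw [hDN, ENNReal.toReal_ofReal (tsum_nonneg fun d => by have := hc d; positivity)]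
  have hder : HasDerivAt (fun N : ℝ => ∑' d, c d * N ^ b d)
      (∑' d, c d * ((b d : ℝ) * (1 : ℝ) ^ (b d - 1))) 1 := by
    refine hasDerivAt_tsum_of_isPreconnected (g := fun d N => c d * N ^ b d)
      (g' := fun d N => c d * ((b d : ℝ) * N ^ (b d - 1))) (t := Set.Ioo 0 r) (y₀ := 1) hsu
      isOpen_Ioo isPreconnected_Ioo ?_ ?_ ⟨by norm_num, hr1⟩ ?_ ⟨by norm_num, hr1⟩
    · intro d y _
      exact (hasDerivAt_pow (b d) y).const_mul (c d)
    · intro d y hy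
      have h0 := hc d
      have hy0 : 0 ≤ y := hy.1.le
      rw [Real.norm_of_nonneg (by positivity)]
      have := hy.2.le
      gcongr
    · refine Summable.of_nonneg_of_le (fun d => by have := hc d; positivity) (fun d => ?_) hsR
      have := hc d
      have := hR.le
      gcongr
  refine hder.congr_of_eventuallyEq ?_
  filter_upwards [lt_mem_nhds (show (0 : ℝ) < 1 by norm_num)] with N hN
  exact hT N hN.le

/-! ### The Rician channel -/

/-- The modified Bessel function `I₀`. -/
def besselI0 (x : ℝ) : ℝ :=
  1 / (2 * Real.pi) * ∫ θ in (-Real.pi)..Real.pi, Real.exp (x * Real.cos θ)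

/-- The Rician density with noncentrality `s` and scale `σ`. -/
def ricianPDF (s σ a : ℝ) : ℝ :=
  a / σ ^ 2 * Real.exp (-((a ^ 2 + s ^ 2) / (2 * σ ^ 2))) * besselI0 (a * s / σ ^ 2)

/-- The Rician distribution. -/
def ricianMeasure (s σ : ℝ) : Measure ℝ :=
  (volume.restrict (Set.Ici 0)).withDensity fun a => ENNReal.ofReal (ricianPDF s σ a)

/-- The channel output `y = √E_c α x + n` when the path `p` is transmitted. -/
def received (G : ConvCode kc nc m) {M : ℕ} (Ec : ℝ) (p : TPath kc) (α ν : Fin M → Fin nc → ℝ) :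
    Fin M → Fin nc → ℝ :=
  fun j i => Real.sqrt Ec * α j i * symbol G p j i + ν j i

/-! ### The Yamamoto-Itoh algorithm

`M` is the number of branches, `α` the fading envelopes, `y` the received samples; the number `c`
stands for `(u / d_f) √(N₀ / 2)`. -/

variable {M : ℕ}

/-- The sum of the branch metrics of the path `p` up to level `t`. -/
def metric (G : ConvCode kc nc m) (α y : Fin M → Fin nc → ℝ) (t : ℕ) (p : TPath kc) : ℝ :=
  ∑ j ∈ Finset.univ.filter (fun j : Fin M => (j : ℕ) < t), ∑ i, α j i * symbol G p j i * y j i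

/-- The flag condition at level `t`: `p` beats `q` by the required margin. -/
def Beats (G : ConvCode kc nc m) (c : ℝ) (α y : Fin M → Fin nc → ℝ) (t : ℕ) (p q : TPath kc) :
    Prop :=
  c * (∑ j ∈ Finset.univ.filter (fun j : Fin M => (j : ℕ) < t), ∑ i, |symbol G q j i - symbol G p j i| * α j i ^ 2) ≤
    ∑ j ∈ Finset.univ.filter (fun j : Fin M => (j : ℕ) < t), ∑ i, α j i * (symbol G p j i - symbol G q j i) * y j i

/-- The node (state) `s` is in the trellis at level `t`. -/
def IsNode (H m t : ℕ) (s : Fin m → Bits kc) : Prop := ∃ p : TPath kc, IsBlock H p ∧ stateAt m p t = s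

/-- Some element of `C` (if there is one) with the largest metric. -/
def bestOf (f : TPath kc → ℝ) (C : Set (TPath kc)) : TPath kc :=
  Classical.epsilon fun q => q ∈ C ∧ ∀ q' ∈ C, f q' ≤ f q

/-- The paths that enter the node `s` at level `t + 1`, when `surv` are the survivors at level
`t`: extensions of survivors by one branch of the trellis (after level `H` the input is zero). -/
def extensions (H m t : ℕ) (surv : (Fin m → Bits kc) → TPath kc) (s : Fin m → Bits kc) :
    Set (TPath kc) :=
  {q | ∃ (s' : Fin m → Bits kc) (w : Bits kc), IsNode H m t s' ∧ (H ≤ t → w = 0) ∧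
    q = Function.update (surv s') t w ∧ stateAt m q (t + 1) = s}

/-- The survivor at the node `s` of level `t` (dynamic programming). -/
def survivor (G : ConvCode kc nc m) (H : ℕ) (α y : Fin M → Fin nc → ℝ) :
    ℕ → (Fin m → Bits kc) → TPath kc
  | 0 => fun _ => 0
  | t + 1 => fun s =>
      bestOf (metric G α y (t + 1)) (extensions H m t (survivor G H α y t) s)

/-- The second best among the paths that enter the node `s` at level `t + 1`. -/
def runnerUp (G : ConvCode kc nc m) (H : ℕ) (α y : Fin M → Fin nc → ℝ) (t : ℕ)
    (s : Fin m → Bits kc) : TPath kc :=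
  bestOf (metric G α y (t + 1))
    (extensions H m t (survivor G H α y t) s \ {survivor G H α y (t + 1) s})

/-- The survivor at the node `s` of level `t + 1` passes the flag test against the second best
path. -/
def PassesFlag (G : ConvCode kc nc m) (H : ℕ) (c : ℝ) (α y : Fin M → Fin nc → ℝ) (t : ℕ)
    (s : Fin m → Bits kc) : Prop :=
  Beats G c α y (t + 1) (survivor G H α y (t + 1) s) (runnerUp G H α y t s)

/-- The survivor at the node `s` of level `t` has label `C` (otherwise it has label `X`). Up to
level `m` all paths have label `C`; from then on a survivor keeps it as long as it passes the
flag tests. -/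
def LabelC (G : ConvCode kc nc m) (H : ℕ) (c : ℝ) (α y : Fin M → Fin nc → ℝ) :
    ℕ → (Fin m → Bits kc) → Prop
  | 0 => fun _ => True
  | t + 1 => fun s => t + 1 ≤ m ∨
      (LabelC G H c α y t (stateAt m (survivor G H α y (t + 1) s) t) ∧ PassesFlag G H c α y t s)

/-- Retransmission is requested: at level `H + m` all survivors have label `X`. -/
def Retransmission (G : ConvCode kc nc m) (H : ℕ) (c : ℝ) (α y : Fin M → Fin nc → ℝ) : Prop :=
  ∀ s : Fin m → Bits kc, IsNode H m (H + m) s → ¬ LabelC G H c α y (H + m) s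

/-- The decoded path: the survivor at the zero state of level `H + m`. -/
def decoded (G : ConvCode kc nc m) (H : ℕ) (α y : Fin M → Fin nc → ℝ) : TPath kc :=
  survivor G H α y (H + m) 0

/-! ### Error and retransmission events, `p` being the transmitted path -/

/-- The transmitted path is the survivor at the node it goes through at level `t`. -/
def Survives (G : ConvCode kc nc m) (H : ℕ) (α y : Fin M → Fin nc → ℝ) (p : TPath kc) (t : ℕ) :
    Prop :=
  ∀ j < t, survivor G H α y t (stateAt m p t) j = p j

/-- First-event error at level `t`: the transmitted path, which has survived so far, is eliminated
by a path merging with it at level `t` which beats it by the margin that the flag requires. -/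
def FirstError (G : ConvCode kc nc m) (H : ℕ) (c : ℝ) (α y : Fin M → Fin nc → ℝ) (p : TPath kc)
    (t : ℕ) : Prop :=
  (∀ τ < t, Survives G H α y p τ) ∧ ¬ Survives G H α y p t ∧
    Beats G c α y t (survivor G H α y t (stateAt m p t)) p

/-- Retransmission event at level `t + 1`: the transmitted path has survived so far, and at its
node the survivor does not pass the flag test, so that it is labelled `X`. -/
def FlagX (G : ConvCode kc nc m) (H : ℕ) (c : ℝ) (α y : Fin M → Fin nc → ℝ) (p : TPath kc)
    (t : ℕ) : Prop :=
  m ≤ t ∧ (∀ τ ≤ t, Survives G H α y p τ) ∧ ¬ PassesFlag G H c α y t (stateAt m p (t + 1))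

/-- The path which follows `p` up to level `s` and `q` from there on. -/
def splice (s : ℕ) (p q : TPath kc) : TPath kc := fun j => if j < s then p j else q j

open Classical in
/-- The number of information bits in error, caused by those detours of the decoded path from the
transmitted path `p` which beat it by the margin that the flag requires. -/
def bitErrors (G : ConvCode kc nc m) (H : ℕ) (c : ℝ) (α y : Fin M → Fin nc → ℝ) (p : TPath kc) :
    ℕ :=
  ∑ t ∈ Finset.range (H + m + 1), ∑ s ∈ Finset.range t,
    if Detour m (decoded G H α y) p s t ∧ Beats G c α y t (splice s p (decoded G H α y)) p then
      ∑ j ∈ Finset.Ico s t, hammingDist (decoded G H α y j) (p j)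
    else 0

/-! ### Performance measures -/

/-- The margin coefficient `(u / d_f) √(N₀ / 2)`. -/
def margin (G : ConvCode kc nc m) (N0 u : ℝ) : ℝ := u / freeDist G * Real.sqrt (N0 / 2)

variable {Ω : Type*} [MeasurableSpace Ω]

/-- `P_e(u)`: first-event error probability at level `t`. -/
def Pe (P : Measure Ω) (G : ConvCode kc nc m) (H : ℕ) (Ec N0 u : ℝ)
    (α ν : Fin (H + m) → Fin nc → Ω → ℝ) (p : TPath kc) (t : ℕ) : ℝ≥0∞ :=
  P {ω | FirstError G H (margin G N0 u) (fun j i => α j i ω)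
    (received G Ec p (fun j i => α j i ω) (fun j i => ν j i ω)) p t}

/-- `P_x(u)`: retransmission probability per branch, at level `t + 1`. -/
def Px (P : Measure Ω) (G : ConvCode kc nc m) (H : ℕ) (Ec N0 u : ℝ)
    (α ν : Fin (H + m) → Fin nc → Ω → ℝ) (p : TPath kc) (t : ℕ) : ℝ≥0∞ :=
  P {ω | FlagX G H (margin G N0 u) (fun j i => α j i ω)
    (received G Ec p (fun j i => α j i ω) (fun j i => ν j i ω)) p t}

/-- The probability that retransmission of the whole block is requested. -/
def PxBlock (P : Measure Ω) (G : ConvCode kc nc m) (H : ℕ) (Ec N0 u : ℝ)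
    (α ν : Fin (H + m) → Fin nc → Ω → ℝ) (p : TPath kc) : ℝ≥0∞ :=
  P {ω | Retransmission G H (margin G N0 u) (fun j i => α j i ω)
    (received G Ec p (fun j i => α j i ω) (fun j i => ν j i ω))}

/-- `P_b(u)`: the bit error probability, i.e. the expected proportion of erroneous bits among the
`H * kc` information bits. -/
def Pb (P : Measure Ω) (G : ConvCode kc nc m) (H : ℕ) (Ec N0 u : ℝ)
    (α ν : Fin (H + m) → Fin nc → Ω → ℝ) (p : TPath kc) : ℝ≥0∞ :=
  (∫⁻ ω, (bitErrors G H (margin G N0 u) (fun j i => α j i ω)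
    (received G Ec p (fun j i => α j i ω) (fun j i => ν j i ω)) p : ℝ≥0∞) ∂P) / (H * kc : ℕ)

/-! ### The function `D̃` -/

/-- The Gaussian tail function. -/
def gaussQ (x : ℝ) : ℝ :=
  1 / Real.sqrt (2 * Real.pi) * ∫ t in Set.Ioi x, Real.exp (-(t ^ 2 / 2))

/-- `A`, with `ρ = E_c / N₀` and `v = u / d_f`. -/
def coefA (ρ v σ : ℝ) : ℝ := 1 / 2 * (Real.sqrt (2 * ρ) + v) ^ 2 + 1 / (2 * σ ^ 2)

/-- `B_θ`. -/
def coefB (σ s θ : ℝ) : ℝ := -(s * Real.cos θ / σ ^ 2)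

/-- `Λ(θ)`. -/
def Lam (ρ v σ s θ : ℝ) : ℝ :=
  1 / (2 * coefA ρ v σ * σ ^ 2) *
    (1 - coefB σ s θ * Real.sqrt (2 * Real.pi) / Real.sqrt (2 * coefA ρ v σ) *
      Real.exp (coefB σ s θ ^ 2 / (4 * coefA ρ v σ)) *
      gaussQ (coefB σ s θ / Real.sqrt (2 * coefA ρ v σ)))

/-- `D̃(ρ, v, σ, s)`, with `γ = s² / (2 σ²)`. -/
def Dtilde (ρ v σ s : ℝ) : ℝ :=
  1 / Real.pi * Real.exp (-(s ^ 2 / (2 * σ ^ 2))) * ∫ θ in (0 : ℝ)..Real.pi, Lam ρ v σ s θ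

end ConvARQ

end

/-! All the events are reduced to one: some detour from the transmitted path `p`, ending at level
`t`, beats `p` with margin coefficient `c` (`Beaten`). A first-event error is such an event with the
margin of the flag (`FirstError.beaten`). A failed flag test gives one with the opposite margin:
either `p` was displaced by a path of at least its metric, or `p` survived and did not clear the
margin over the runner-up (`beaten_of_not_survives_or_not_passesFlag`). If no detour beats `p` with
margin `-c` at any of the levels `m + 1, …, m + H`, then `p` survives with label C to the end, which
rules out retransmission (`Retransmission.exists_beaten`).

By linearity and time invariance of the encoder, the detours from `p` are translates of the detours
from the zero path, and the number of differing code bits is the weight of the zero detour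
(`codeBits_perturb`, `Detour.segment_mem`, `card_differing`).

For a fixed competitor only the differing positions matter. With `κ = √Ec + c`, beating means that
the sum of `-κα² - αxn` over them is nonnegative. If `κ ≥ 0`, the Chernoff bound with exponent
`2κ/N₀` applies (`one_le_prod_tilt`); the upper bound on `u` is what secures this for the negative
margin. Averaging one factor over the noise leaves `exp(-κ²α²/N₀)`, whose Rician mean is `D̃`
(`lintegral_rician`, `lintegral_tilt`). Independence then yields `D̃` to the power of the weight
(`lintegral_chernoff`).

The union bound over zero detours gives `T` (`measure_beaten_le`). Weighting each detour by its
information bits and summing over the `H` possible starting levels gives `∂T/∂N` (`bitErrors_le`,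
`Channel.lintegral_bitErrors_le`). -/

namespace ConvARQ

/-! ### Combinatorics of the trellis: prefixes, detours, survivors and labels -/

section Trellis

variable {kc nc m H : ℕ}

theorem stateAt_congr {p q : TPath kc} {t : ℕ} (h : ∀ j < t, p j = q j) :
    stateAt m p t = stateAt m q t := by
  funext i
  unfold stateAt
  split_ifs with hi
  · exact h _ (by omega)
  · rfl

theorem stateAt_succ_congr {p q : TPath kc} {t : ℕ} (h : stateAt m p t = stateAt m q t)
    (ht : p t = q t) : stateAt m p (t + 1) = stateAt m q (t + 1) := by
  funext i
  by_cases hi : (i : ℕ) = 0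
  · simp [stateAt, hi, ht]
  · have := congrFun h ⟨i - 1, by omega⟩
    simp only [stateAt] at this ⊢
    by_cases hit : (i : ℕ) < t + 1
    · rw [if_pos (by omega), if_pos (by omega)] at this
      rw [if_pos hit, if_pos hit]
      have e : t + 1 - 1 - (i : ℕ) = t - 1 - (i - 1) := by omega
      rw [e]; exact this
    · rw [if_neg hit, if_neg hit]

theorem codeBits_congr (G : ConvCode kc nc m) {p q : TPath kc} {j : ℕ}
    (h : ∀ i ≤ j, p i = q i) : codeBits G p j = codeBits G q j := by
  unfold codeBits
  refine Finset.sum_congr rfl fun l _ => ?_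
  rw [h _ (by omega)]

theorem symbol_congr (G : ConvCode kc nc m) {p q : TPath kc} {j : ℕ}
    (h : ∀ i ≤ j, p i = q i) (i : Fin nc) : symbol G p j i = symbol G q j i := by
  unfold symbol
  rw [codeBits_congr G h]

theorem metric_congr (G : ConvCode kc nc m) {M : ℕ} (α y : Fin M → Fin nc → ℝ) {p q : TPath kc}
    {t : ℕ} (h : ∀ j < t, p j = q j) : metric G α y t p = metric G α y t q := by
  unfold metric
  refine Finset.sum_congr rfl fun j hj => Finset.sum_congr rfl fun i _ => ?_
  rw [symbol_congr G fun i hi => h i (lt_of_le_of_lt hi (Finset.mem_filter.mp hj).2)]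

theorem beats_congr (G : ConvCode kc nc m) {M : ℕ} {c : ℝ} {α y : Fin M → Fin nc → ℝ}
    {p p' q q' : TPath kc} {t : ℕ} (hp : ∀ j < t, p j = p' j) (hq : ∀ j < t, q j = q' j)
    (h : Beats G c α y t p q) : Beats G c α y t p' q' := by
  have key : ∀ j ∈ Finset.univ.filter (fun j : Fin M => (j : ℕ) < t), ∀ i,
      symbol G p j i = symbol G p' j i ∧ symbol G q j i = symbol G q' j i := fun j hj i =>
    ⟨symbol_congr G (fun k hk => hp k (lt_of_le_of_lt hk (Finset.mem_filter.mp hj).2)) i,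
     symbol_congr G (fun k hk => hq k (lt_of_le_of_lt hk (Finset.mem_filter.mp hj).2)) i⟩
  unfold Beats at h ⊢
  convert h using 2
  · exact Finset.sum_congr rfl fun j hj => Finset.sum_congr rfl fun i _ => by
      rw [(key j hj i).1, (key j hj i).2]
  · refine Finset.sum_congr rfl fun i _ => ?_
    rw [(key _ ‹_› i).1, (key _ ‹_› i).2]

theorem metric_sub (G : ConvCode kc nc m) {M : ℕ} (α y : Fin M → Fin nc → ℝ) (t : ℕ)
    (p q : TPath kc) :
    ∑ j ∈ Finset.univ.filter (fun j : Fin M => (j : ℕ) < t),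
      ∑ i, α j i * (symbol G p j i - symbol G q j i) * y j i =
    metric G α y t p - metric G α y t q := by
  unfold metric
  rw [← Finset.sum_sub_distrib]
  refine Finset.sum_congr rfl fun j _ => ?_
  rw [← Finset.sum_sub_distrib]
  exact Finset.sum_congr rfl fun i _ => by ring

/-- The weighted distance is nonnegative, so a margin `-c` with `c ≥ 0` only weakens a metric
comparison. -/
theorem beats_neg_of_metric_le (G : ConvCode kc nc m) {M : ℕ} {c : ℝ} (hc : 0 ≤ c)
    {α y : Fin M → Fin nc → ℝ} {p q : TPath kc} {t : ℕ}
    (h : metric G α y t p ≤ metric G α y t q) : Beats G (-c) α y t q p := by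
  unfold Beats
  rw [metric_sub]
  have : 0 ≤ ∑ j ∈ Finset.univ.filter (fun j : Fin M => (j : ℕ) < t),
      ∑ i, |symbol G p j i - symbol G q j i| * α j i ^ 2 :=
    Finset.sum_nonneg fun j _ => Finset.sum_nonneg fun i _ => by positivity
  nlinarith

/-- The weighted distance is symmetric and the metric difference antisymmetric in the two paths.
This is where the sign change of `u` in the retransmission bound originates. -/
theorem beats_neg_of_not_beats (G : ConvCode kc nc m) {M : ℕ} {c : ℝ}
    {α y : Fin M → Fin nc → ℝ} {p q : TPath kc} {t : ℕ}
    (h : ¬ Beats G c α y t p q) : Beats G (-c) α y t q p := by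
  unfold Beats at h ⊢
  rw [metric_sub] at h ⊢
  have e : ∑ j ∈ Finset.univ.filter (fun j : Fin M => (j : ℕ) < t),
      ∑ i, |symbol G p j i - symbol G q j i| * α j i ^ 2 =
      ∑ j ∈ Finset.univ.filter (fun j : Fin M => (j : ℕ) < t),
      ∑ i, |symbol G q j i - symbol G p j i| * α j i ^ 2 := by
    simp_rw [abs_sub_comm]
  rw [e]
  linarith

/-! ### Detours as translates of detours from the zero state -/

/-- The path `p`, to which the path `d`, delayed by `s` levels, is added. -/
def perturb (p : TPath kc) (s : ℕ) (d : TPath kc) : TPath kc :=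
  fun j => p j + if s ≤ j then d (j - s) else 0

/-- The difference of the paths `q` and `p` between the levels `s` and `t`, moved to level `0`. -/
def segment (p q : TPath kc) (s t : ℕ) : ℕ × TPath kc :=
  (t - s, fun j => if j < t - s then q (s + j) - p (s + j) else 0)

/-- Linearity and time invariance of the encoder: the added path contributes its own code word,
delayed. -/
theorem codeBits_perturb (G : ConvCode kc nc m) (p d : TPath kc) (s j : ℕ) :
    codeBits G (perturb p s d) j =
      codeBits G p j + if s ≤ j then codeBits G d (j - s) else 0 := by
  unfold codeBits
  split_ifs with hsj
  · rw [← Finset.sum_add_distrib]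
    refine Finset.sum_congr rfl fun l _ => ?_
    by_cases h1 : (l : ℕ) ≤ j
    · rw [if_pos h1, if_pos h1]
      unfold perturb
      by_cases h2 : (l : ℕ) ≤ j - s
      · rw [if_pos h2, if_pos (by omega), Matrix.mulVec_add,
          show j - (l : ℕ) - s = j - s - l by omega]
      · rw [if_neg h2, if_neg (by omega)]
        simp
    · rw [if_neg h1, if_neg h1, if_neg (by omega)]
      simp
  · rw [add_zero]
    refine Finset.sum_congr rfl fun l _ => ?_
    unfold perturb
    rw [if_neg (show ¬ s ≤ j - l by omega), add_zero]

theorem perturb_segment {p q : TPath kc} {s t : ℕ} (hst : s < t) {j : ℕ} (hj : j < t) :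
    perturb p s (segment p q s t).2 j = splice s p q j := by
  unfold perturb segment splice
  by_cases h : s ≤ j
  · have e : s + (j - s) = j := by omega
    simp only [if_pos h, if_neg (show ¬ j < s by omega), if_pos (show j - s < t - s by omega), e]
    abel
  · simp [h, show j < s by omega]

/-- Register entries reaching back before level `s` hold blocks common to `p` and `q`, because the
states agree at `s`; their difference is the zero that the segment has there. -/
theorem stateAt_segment {p q : TPath kc} {s t τ : ℕ} (h : stateAt m p s = stateAt m q s)
    (hτ : τ ≤ t - s) :
    stateAt m (segment p q s t).2 τ = stateAt m q (s + τ) - stateAt m p (s + τ) := by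
  funext i
  simp only [stateAt, segment, Pi.sub_apply]
  by_cases hi : (i : ℕ) < τ
  · have e : s + (τ - 1 - (i : ℕ)) = s + τ - 1 - i := by omega
    rw [if_pos hi, if_pos (by omega), if_pos (by omega), if_pos (by omega), e]
  · rw [if_neg hi]
    split_ifs with h2
    · have := congrFun h ⟨i - τ, by omega⟩
      simp only [stateAt] at this
      rw [if_pos (by omega), if_pos (by omega)] at this
      have e : s - 1 - ((i : ℕ) - τ) = s + τ - 1 - i := by omega
      rw [e] at this
      rw [this, sub_self]
    · rw [sub_self]

theorem stateAt_zero_path (τ : ℕ) : stateAt m (0 : TPath kc) τ = 0 := by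
  funext i; simp [stateAt]

theorem Detour.symm {p q : TPath kc} {s t : ℕ} (h : Detour m p q s t) : Detour m q p s t :=
  ⟨h.1, h.2.1.symm, h.2.2.1.symm, fun τ h1 h2 => (h.2.2.2.1 τ h1 h2).symm, h.2.2.2.2.symm⟩

theorem Detour.segment_mem {p q : TPath kc} {s t : ℕ} (h : Detour m p q s t) :
    segment p q s t ∈ ZeroDetours kc m := by
  obtain ⟨hst, hs, hne, hmid, ht⟩ := h
  refine ⟨⟨?_, ?_, ?_, ?_, ?_⟩, ?_⟩
  · simp only [segment]; omega
  · funext i; simp [stateAt]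
  · simp only [segment, if_pos (show 0 < t - s by omega), add_zero]
    exact sub_ne_zero.mpr hne.symm
  · intro τ h1 h2
    simp only [segment] at h2
    rw [stateAt_segment hs h2.le]
    have := hmid (s + τ) (by omega) (by omega)
    rw [stateAt_zero_path]
    exact sub_ne_zero.mpr this.symm
  · change stateAt m _ (t - s) = _
    rw [stateAt_segment hs le_rfl, show s + (t - s) = t by omega, ht, sub_self]
    exact (stateAt_zero_path _).symm
  · intro j hj
    simp only [segment] at hj ⊢
    rw [if_neg (by omega)]

theorem inWeight_segment (p q : TPath kc) (s t : ℕ) :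
    inWeight (segment p q s t) = ∑ j ∈ Finset.Ico s t, hammingDist (q j) (p j) := by
  rw [Finset.sum_Ico_eq_sum_range]
  refine Finset.sum_congr rfl fun j hj => ?_
  simp only [segment, Finset.mem_range] at hj ⊢
  rw [if_pos hj, hammingDist_comm, hammingDist_eq_hammingNorm, sub_eq_neg_add]

/-- Some detour from the path `p` that ends at level `t` beats `p`. -/
def Beaten (G : ConvCode kc nc m) {M : ℕ} (c : ℝ) (α y : Fin M → Fin nc → ℝ) (p : TPath kc)
    (t : ℕ) : Prop :=
  ∃ d ∈ ZeroDetours kc m, d.1 ≤ t ∧ Beats G c α y t (perturb p (t - d.1) d.2) p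

/-- Since `q` follows `p` before level `s`, up to level `t` it is `p` perturbed by its own
difference segment. -/
theorem Detour.beaten {G : ConvCode kc nc m} {M : ℕ} {c : ℝ} {α y : Fin M → Fin nc → ℝ}
    {p q : TPath kc} {s t : ℕ} (h : Detour m p q s t) (hpre : ∀ j < s, q j = p j)
    (hb : Beats G c α y t q p) : Beaten G c α y p t := by
  refine ⟨segment p q s t, h.segment_mem, Nat.sub_le _ _, ?_⟩
  have hst := h.1
  have e : t - (segment p q s t).1 = s := by simp only [segment]; omega
  rw [e]
  refine beats_congr G (fun j hj => ?_) (fun _ _ => rfl) hb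
  rw [perturb_segment hst hj]
  unfold splice
  split_ifs with hjs
  · exact hpre j hjs
  · rfl

/-! ### Survivors -/

theorem bestOf_spec (f : TPath kc → ℝ) {C : Set (TPath kc)} (hC : C.Finite) (hne : C.Nonempty) :
    bestOf f C ∈ C ∧ ∀ q ∈ C, f q ≤ f (bestOf f C) := by
  obtain ⟨a, ha, hmax⟩ := Set.exists_max_image C f hC hne
  exact Classical.epsilon_spec (p := fun q => q ∈ C ∧ ∀ q' ∈ C, f q' ≤ f q) ⟨a, ha, hmax⟩

theorem extensions_finite (t : ℕ) (surv : (Fin m → Bits kc) → TPath kc) (s : Fin m → Bits kc) :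
    (extensions H m t surv s).Finite := by
  refine (Set.finite_range fun x : (Fin m → Bits kc) × Bits kc =>
    Function.update (surv x.1) t x.2).subset ?_
  rintro q ⟨s', w, -, -, rfl, -⟩
  exact ⟨(s', w), rfl⟩

theorem isNode_stateAt {p : TPath kc} (hp : IsBlock H p) (t : ℕ) :
    IsNode H m t (stateAt m p t) := ⟨p, hp, rfl⟩

variable {M : ℕ} (G : ConvCode kc nc m) (α y : Fin M → Fin nc → ℝ)

theorem stateAt_update (q : TPath kc) (t : ℕ) (w : Bits kc) :
    stateAt m (Function.update q t w) t = stateAt m q t :=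
  stateAt_congr fun j hj => by rw [Function.update_of_ne hj.ne]

/-- The extension of the survivor by the branch of a block path enters the next node. -/
theorem update_mem_extensions {t : ℕ} {surv : (Fin m → Bits kc) → TPath kc} {p : TPath kc}
    (hp : IsBlock H p) (hsurv : stateAt m (surv (stateAt m p t)) t = stateAt m p t) :
    Function.update (surv (stateAt m p t)) t (p t) ∈
      extensions H m t surv (stateAt m p (t + 1)) := by
  refine ⟨_, _, isNode_stateAt hp t, fun h => hp t h, rfl, ?_⟩
  refine stateAt_succ_congr ?_ (by simp)
  rw [stateAt_update, hsurv]

theorem survivor_succ_spec {t : ℕ}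
    (ih : ∀ s, IsNode H m t s → stateAt m (survivor G H α y t s) t = s)
    {s : Fin m → Bits kc} (hs : IsNode H m (t + 1) s) :
    survivor G H α y (t + 1) s ∈ extensions H m t (survivor G H α y t) s ∧
    ∀ q ∈ extensions H m t (survivor G H α y t) s,
      metric G α y (t + 1) q ≤ metric G α y (t + 1) (survivor G H α y (t + 1) s) := by
  obtain ⟨p, hp, rfl⟩ := hs
  exact bestOf_spec (metric G α y (t + 1)) (extensions_finite t _ _)
    ⟨_, update_mem_extensions hp (ih _ (isNode_stateAt hp t))⟩

theorem stateAt_survivor {t : ℕ} {s : Fin m → Bits kc} (hs : IsNode H m t s) :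
    stateAt m (survivor G H α y t s) t = s := by
  induction t generalizing s with
  | zero =>
    obtain ⟨p, -, rfl⟩ := hs
    funext i; simp [stateAt]
  | succ t ih =>
    obtain ⟨_, _, _, _, _, h⟩ := (survivor_succ_spec G α y (fun s hs => ih hs) hs).1
    exact h

theorem survivor_mem_extensions {t : ℕ} {s : Fin m → Bits kc} (hs : IsNode H m (t + 1) s) :
    survivor G H α y (t + 1) s ∈ extensions H m t (survivor G H α y t) s :=
  (survivor_succ_spec G α y (fun _ hs => stateAt_survivor G α y hs) hs).1

theorem metric_le_survivor {t : ℕ} {s : Fin m → Bits kc} (hs : IsNode H m (t + 1) s)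
    {q : TPath kc} (hq : q ∈ extensions H m t (survivor G H α y t) s) :
    metric G α y (t + 1) q ≤ metric G α y (t + 1) (survivor G H α y (t + 1) s) :=
  (survivor_succ_spec G α y (fun _ hs => stateAt_survivor G α y hs) hs).2 q hq

theorem survivor_eq_zero {t : ℕ} {s : Fin m → Bits kc} (hs : IsNode H m t s) {j : ℕ}
    (hj : t ≤ j ∨ H ≤ j) : survivor G H α y t s j = 0 := by
  induction t generalizing s with
  | zero => rfl
  | succ t ih =>
    obtain ⟨s', w, hs', hw, e, -⟩ := survivor_mem_extensions G α y hs
    rw [e]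
    by_cases hjt : j = t
    · subst hjt
      rw [Function.update_self]
      exact hw (by omega)
    · rw [Function.update_of_ne hjt]
      exact ih hs' (by omega)

theorem extensions_eq_zero {t : ℕ} {s : Fin m → Bits kc} {q : TPath kc}
    (hq : q ∈ extensions H m t (survivor G H α y t) s) {j : ℕ} (hj : t + 1 ≤ j) : q j = 0 := by
  obtain ⟨s', w, hs', -, rfl, -⟩ := hq
  rw [Function.update_of_ne (by omega)]
  exact survivor_eq_zero G α y hs' (by omega)

/-- The initial segments of survivors are survivors. -/
theorem survivor_prefix {t : ℕ} {s : Fin m → Bits kc} (hs : IsNode H m t s) {τ : ℕ} (hτ : τ ≤ t)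
    {j : ℕ} (hj : j < τ) :
    survivor G H α y τ (stateAt m (survivor G H α y t s) τ) j = survivor G H α y t s j := by
  induction t generalizing s with
  | zero => omega
  | succ t ih =>
    rcases Nat.lt_or_ge t τ with h | h
    · obtain rfl : τ = t + 1 := by omega
      rw [stateAt_survivor G α y hs]
    · obtain ⟨s', w, hs', hw, e, -⟩ := survivor_mem_extensions G α y hs
      have e2 : ∀ k < τ, survivor G H α y (t + 1) s k = survivor G H α y t s' k := fun k hk => by
        rw [e, Function.update_of_ne (by omega)]
      rw [stateAt_congr e2, e2 j hj]
      exact ih hs' h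

theorem extensions_prefix {t : ℕ} {s : Fin m → Bits kc} {q : TPath kc}
    (hq : q ∈ extensions H m t (survivor G H α y t) s) {τ : ℕ} (hτ : τ ≤ t) {j : ℕ} (hj : j < τ) :
    survivor G H α y τ (stateAt m q τ) j = q j := by
  obtain ⟨s', w, hs', -, rfl, -⟩ := hq
  have e2 : ∀ k < τ, Function.update (survivor G H α y t s') t w k =
      survivor G H α y t s' k := fun k hk => Function.update_of_ne (by omega) _ _
  rw [stateAt_congr e2, e2 j hj]
  exact survivor_prefix G α y hs' hτ hj

/-- A path entering a node of the transmitted path, which has survived so far, is a detour from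
the transmitted path. -/
theorem exists_detour {p : TPath kc} {t : ℕ} (hsurv : ∀ τ ≤ t, Survives G H α y p τ)
    {q : TPath kc}
    (hq : q ∈ extensions H m t (survivor G H α y t) (stateAt m p (t + 1)))
    (hne : ∃ j < t + 1, q j ≠ p j) :
    ∃ s, Detour m p q s (t + 1) ∧ ∀ j < s, q j = p j := by
  classical
  -- The last level up to `t` at which the states agree; level `0` always qualifies.
  set s := Nat.findGreatest (fun τ => stateAt m p τ = stateAt m q τ) t with hsdef
  have hst : s ≤ t := Nat.findGreatest_le t
  have hs : stateAt m p s = stateAt m q s :=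
    Nat.findGreatest_spec (P := fun τ => stateAt m p τ = stateAt m q τ) (Nat.zero_le t)
      (by funext i; simp [stateAt])
  have hend : stateAt m p (t + 1) = stateAt m q (t + 1) := by
    obtain ⟨_, _, _, _, _, h⟩ := hq
    exact h.symm
  -- At the common node of level `s` the initial segments of both `q` and `p` are the survivor.
  have hpre : ∀ j < s, q j = p j := fun j hj => by
    rw [← extensions_prefix G α y hq hst hj, ← hs]
    exact hsurv s hst j hj
  have hmid : ∀ τ, s < τ → τ < t + 1 → stateAt m p τ ≠ stateAt m q τ := fun τ h1 h2 =>
    Nat.findGreatest_is_greatest (P := fun τ => stateAt m p τ = stateAt m q τ) h1 (by omega)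
  refine ⟨s, ⟨by omega, hs, fun heq => ?_, hmid, hend⟩, hpre⟩
  -- Equal blocks at `s` would make the states agree at `s + 1`, against maximality; if `s = t`,
  -- they would make `q` agree with `p` on the whole range.
  rcases Nat.lt_or_ge s t with h | h
  · exact hmid (s + 1) (by omega) (by omega) (stateAt_succ_congr hs heq)
  · obtain ⟨j, hj, hj2⟩ := hne
    rcases Nat.lt_or_ge j s with h3 | h3
    · exact hj2 (hpre j h3)
    · obtain rfl : j = s := by omega
      exact hj2 heq.symm

theorem beaten_of_mem_extensions {c : ℝ} {p : TPath kc} {t : ℕ}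
    (hsurv : ∀ τ ≤ t, Survives G H α y p τ) {q : TPath kc}
    (hq : q ∈ extensions H m t (survivor G H α y t) (stateAt m p (t + 1)))
    (hne : ∃ j < t + 1, q j ≠ p j) (hb : Beats G c α y (t + 1) q p) :
    Beaten G c α y p (t + 1) := by
  obtain ⟨s, hd, hpre⟩ := exists_detour G α y hsurv hq hne
  exact hd.beaten hpre hb

theorem FirstError.beaten {c : ℝ} {p : TPath kc} (hp : IsBlock H p) {t : ℕ}
    (h : FirstError G H c α y p t) : Beaten G c α y p t := by
  obtain ⟨h1, h2, h3⟩ := h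
  cases t with
  | zero => exact absurd (fun j hj => absurd hj (Nat.not_lt_zero j)) h2
  | succ t =>
    unfold Survives at h2
    push Not at h2
    exact beaten_of_mem_extensions G α y (fun τ hτ => h1 τ (by omega))
      (survivor_mem_extensions G α y (isNode_stateAt hp _)) h2 h3

/-- From level `m + 1` up to the end of the trellis, at least two paths enter every node. -/
theorem extensions_nontrivial (hkc : 0 < kc) {p : TPath kc} (hp : IsBlock H p) {t : ℕ}
    (hmt : m ≤ t) (htH : t < H + m) (b : TPath kc) :
    (extensions H m t (survivor G H α y t) (stateAt m p (t + 1)) \ {b}).Nonempty := by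
  -- Block `t - m` is a data block because `t < H + m`. It has left the register at level `t + 1`,
  -- but at level `t` it is still the oldest entry, or the branch input itself if `m = 0`. Hence the
  -- two paths enter the same node by different branches.
  let p' : TPath kc := Function.update p (t - m) (p (t - m) + fun _ => 1)
  have hone : (fun _ => 1 : Bits kc) ≠ 0 := fun h => by
    simpa using congrFun h ⟨0, hkc⟩
  have hp' : IsBlock H p' := fun j hj => by
    simp only [p']
    rw [Function.update_of_ne (by omega)]
    exact hp j hj
  have hend : stateAt m p' (t + 1) = stateAt m p (t + 1) := by
    funext i
    simp only [stateAt, p']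
    rw [Function.update_of_ne (by omega)]
  have h1 := update_mem_extensions hp
    (stateAt_survivor G α y (isNode_stateAt (m := m) hp t))
  have h2 := update_mem_extensions hp'
    (stateAt_survivor G α y (isNode_stateAt (m := m) hp' t))
  rw [hend] at h2
  have hne : Function.update (survivor G H α y t (stateAt m p t)) t (p t) ≠
      Function.update (survivor G H α y t (stateAt m p' t)) t (p' t) := by
    intro h
    have hs : stateAt m p t = stateAt m p' t := by
      have := congrArg (fun q => stateAt m q t) h
      simp only [stateAt_update] at this
      rwa [stateAt_survivor G α y (isNode_stateAt hp t),
        stateAt_survivor G α y (isNode_stateAt hp' t)] at this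
    have ht : p t = p' t := by simpa using congrFun h t
    have key : p (t - m) = p' (t - m) := by
      rcases Nat.eq_zero_or_pos m with hm | hm
      · have e : t - m = t := by omega
        rw [e]; exact ht
      · have := congrFun hs ⟨m - 1, by omega⟩
        simp only [stateAt] at this
        rw [if_pos (by omega), if_pos (by omega),
          show t - 1 - (m - 1) = t - m by omega] at this
        exact this
    simp only [p', Function.update_self, left_eq_add] at key
    exact hone key
  by_cases hb : Function.update (survivor G H α y t (stateAt m p t)) t (p t) = b
  · exact ⟨_, h2, fun h => hne (hb.trans h.symm)⟩
  · exact ⟨_, h1, hb⟩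

/-- If `p` survives, the competitor is the runner-up, which exists because at least two paths enter
the node. If not, it is the new survivor, whose metric is at least that of `p`. -/
theorem beaten_of_not_survives_or_not_passesFlag (hkc : 0 < kc) {c : ℝ} (hc : 0 ≤ c) {p : TPath kc}
    (hp : IsBlock H p) {t : ℕ} (hmt : m ≤ t) (htH : t < H + m)
    (hsurv : ∀ τ ≤ t, Survives G H α y p τ)
    (h : ¬ Survives G H α y p (t + 1) ∨ ¬ PassesFlag G H c α y t (stateAt m p (t + 1))) :
    Beaten G (-c) α y p (t + 1) := by
  have hnode := isNode_stateAt (m := m) hp (t + 1)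
  by_cases hS : Survives G H α y p (t + 1)
  · have hne := extensions_nontrivial G α y hkc hp hmt htH
      (survivor G H α y (t + 1) (stateAt m p (t + 1)))
    have hru := (bestOf_spec (metric G α y (t + 1))
      ((extensions_finite t _ _).subset Set.sdiff_subset) hne).1
    change runnerUp G H α y t (stateAt m p (t + 1)) ∈ _ at hru
    refine beaten_of_mem_extensions G α y hsurv hru.1 ?_ ?_
    -- Both paths are zero from level `t + 1` on, so agreement with `p` before it would identify the
    -- runner-up with the survivor that was removed.
    · by_contra! hcon
      refine hru.2 (funext fun j => ?_)
      rcases Nat.lt_or_ge j (t + 1) with hj | hj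
      · rw [hcon j hj, hS j hj]
      · rw [extensions_eq_zero G α y hru.1 hj, survivor_eq_zero G α y hnode (Or.inl hj)]
    · have hflag := h.resolve_left (not_not.mpr hS)
      exact beats_congr G (fun _ _ => rfl) hS (beats_neg_of_not_beats G hflag)
  · refine beaten_of_mem_extensions G α y hsurv (survivor_mem_extensions G α y hnode) ?_ ?_
    · unfold Survives at hS
      push Not at hS
      exact hS
    · refine beats_neg_of_metric_le G hc ?_
      have h1 := update_mem_extensions hp
        (stateAt_survivor G α y (isNode_stateAt (m := m) hp t))
      refine le_of_eq_of_le (metric_congr G α y fun j hj => ?_) (metric_le_survivor G α y hnode h1)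
      by_cases hjt : j = t
      · subst hjt; simp
      · rw [Function.update_of_ne hjt]
        exact (hsurv t le_rfl j (by omega)).symm

theorem FlagX.beaten (hkc : 0 < kc) {c : ℝ} (hc : 0 ≤ c) {p : TPath kc} (hp : IsBlock H p) {t : ℕ}
    (htH : t < H + m) (h : FlagX G H c α y p t) : Beaten G (-c) α y p (t + 1) :=
  beaten_of_not_survives_or_not_passesFlag G α y hkc hc hp h.1 htH h.2.1 (Or.inr h.2.2)

/-- Otherwise induction on the level shows that `p` keeps surviving with label C, so its final node
contradicts the request. -/
theorem Retransmission.exists_beaten (hkc : 0 < kc) {c : ℝ} (hc : 0 ≤ c) {p : TPath kc}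
    (hp : IsBlock H p) (h : Retransmission G H c α y) :
    ∃ k < H, Beaten G (-c) α y p (m + k + 1) := by
  by_contra! hcon
  have key : ∀ t ≤ H + m, (∀ τ ≤ t, Survives G H α y p τ) ∧
      LabelC G H c α y t (stateAt m p t) := by
    intro t
    induction t with
    | zero =>
      intro _
      refine ⟨fun τ hτ j hj => by omega, ?_⟩
      simp [LabelC]
    | succ t ih =>
      intro ht
      obtain ⟨hS, hL⟩ := ih (by omega)
      have hnode := isNode_stateAt (m := m) hp (t + 1)
      rcases Nat.lt_or_ge t m with htm | htm
      · refine ⟨fun τ hτ => ?_, ?_⟩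
        · rcases Nat.lt_or_ge t τ with h1 | h1
          · obtain rfl : τ = t + 1 := by omega
            intro j hj
            -- Up to level `m` the register still holds the whole input, so the node determines the
            -- path.
            have := congrFun (stateAt_survivor G α y hnode) ⟨t - j, by omega⟩
            simp only [stateAt] at this
            rw [if_pos (by omega), if_pos (by omega),
              show t + 1 - 1 - (t - j) = j by omega] at this
            exact this
          · exact hS τ h1
        · unfold LabelC
          exact Or.inl (by omega)
      · have hnb := hcon (t - m) (by omega)
        rw [show m + (t - m) + 1 = t + 1 by omega] at hnb
        have hpass := mt (beaten_of_not_survives_or_not_passesFlag G α y hkc hc hp htm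
          (by omega) hS) hnb
        push Not at hpass
        refine ⟨fun τ hτ => ?_, ?_⟩
        · rcases Nat.lt_or_ge t τ with h1 | h1
          · obtain rfl : τ = t + 1 := by omega
            exact hpass.1
          · exact hS τ h1
        · unfold LabelC
          refine Or.inr ⟨?_, hpass.2⟩
          rw [stateAt_congr (q := p) fun j hj => hpass.1 j (by omega)]
          exact hL
  exact h _ (isNode_stateAt hp _) (key _ le_rfl).2

theorem decoded_eq_zero {j : ℕ} (hj : H ≤ j) : decoded G H α y j = 0 :=
  survivor_eq_zero G α y ⟨0, fun _ _ => rfl, stateAt_zero_path _⟩ (Or.inr hj)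

instance countable_zeroDetours : Countable (ZeroDetours kc m) := by
  -- A zero detour vanishes after its end, so its length and finitely many blocks determine it.
  let f : ZeroDetours kc m → Σ L : ℕ, (Fin L → Bits kc) := fun d => ⟨d.1.1, fun i => d.1.2 i⟩
  refine Function.Injective.countable (f := f) ?_
  rintro ⟨⟨L, d⟩, hd⟩ ⟨⟨L', d'⟩, hd'⟩ h
  obtain rfl : L = L' := congrArg Sigma.fst h
  have h2 : (fun i : Fin L => d i) = fun i : Fin L => d' i := by simpa [f] using h
  have : d = d' := by
    funext j
    rcases Nat.lt_or_ge j L with hj | hj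
    · exact congrFun h2 ⟨j, hj⟩
    · exact (hd.2 j hj).trans (hd'.2 j hj).symm
  subst this
  rfl

end Trellis

/-! ### Rician and Gaussian integrals for one symbol, and independence -/

section Channel

theorem integrable_exp_quadratic {A : ℝ} (hA : 0 < A) (B : ℝ) :
    Integrable fun a : ℝ => Real.exp (-(A * a ^ 2) - B * a) := by
  have h := (integrable_cexp_quadratic (b := (A : ℂ)) (by simpa using hA) (-B : ℂ) 0).norm
  refine h.congr (Filter.Eventually.of_forall fun a => ?_)
  simp only [Complex.norm_exp]
  congr 1
  have e : (-(A : ℂ) * a ^ 2 + -B * a + 0) = ((-(A * a ^ 2) - B * a : ℝ) : ℂ) := by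
    push_cast; ring
  rw [e, Complex.ofReal_re]

theorem integrableOn_mul_exp_quadratic {A : ℝ} (hA : 0 < A) (B : ℝ) :
    IntegrableOn (fun a : ℝ => a * Real.exp (-(A * a ^ 2) - B * a)) (Set.Ioi 0) := by
  refine Integrable.mono' (integrable_exp_quadratic hA (B - 1)).integrableOn
    (by fun_prop) ?_
  refine (ae_restrict_iff' measurableSet_Ioi).mpr (Filter.Eventually.of_forall fun a ha => ?_)
  have ha : 0 < a := ha
  rw [Real.norm_of_nonneg (by positivity)]
  calc a * Real.exp (-(A * a ^ 2) - B * a)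
      ≤ Real.exp a * Real.exp (-(A * a ^ 2) - B * a) := by
        have := Real.add_one_le_exp a
        gcongr
        linarith
    _ = Real.exp (-(A * a ^ 2) - (B - 1) * a) := by
        rw [← Real.exp_add]; congr 1; ring

theorem tendsto_exp_quadratic {A : ℝ} (hA : 0 < A) (B : ℝ) :
    Filter.Tendsto (fun a : ℝ => Real.exp (-(A * a ^ 2) - B * a)) Filter.atTop (nhds 0) := by
  refine Real.tendsto_exp_atBot.comp ?_
  have h : Filter.Tendsto (fun a : ℝ => -(a * (A * a + B))) Filter.atTop Filter.atBot :=
    Filter.tendsto_neg_atTop_atBot.comp (Filter.tendsto_id.atTop_mul_atTop₀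
      (Filter.tendsto_atTop_add_const_right _ _ (Filter.tendsto_id.const_mul_atTop hA)))
  refine h.congr fun a => by ring

/-- Integrate the derivative of `exp(-Aa² - Ba)`, which drops from `1` at the origin to `0` at
infinity. -/
theorem integral_mul_exp_quadratic {A : ℝ} (hA : 0 < A) (B : ℝ) :
    ∫ a in Set.Ioi (0 : ℝ), a * Real.exp (-(A * a ^ 2) - B * a) =
      1 / (2 * A) * (1 - B * ∫ a in Set.Ioi (0 : ℝ), Real.exp (-(A * a ^ 2) - B * a)) := by
  have h1 := integrableOn_mul_exp_quadratic hA B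
  have h2 := (integrable_exp_quadratic hA B).integrableOn (s := Set.Ioi (0 : ℝ))
  have hd : ∀ a ∈ Set.Ici (0 : ℝ), HasDerivAt (fun a : ℝ => Real.exp (-(A * a ^ 2) - B * a))
      ((-(2 * A)) * (a * Real.exp (-(A * a ^ 2) - B * a)) -
        B * Real.exp (-(A * a ^ 2) - B * a)) a := fun a _ => by
    have := ((((hasDerivAt_pow 2 a).const_mul A).neg).sub ((hasDerivAt_id a).const_mul B)).exp
    refine this.congr_deriv ?_
    simp only [Pi.sub_apply, Pi.neg_apply, id]
    push_cast
    ring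
  have key := integral_Ioi_of_hasDerivAt_of_tendsto' hd
    ((h1.const_mul (-(2 * A))).sub (h2.const_mul B)) (tendsto_exp_quadratic hA B)
  rw [integral_sub (h1.const_mul _) (h2.const_mul _), integral_const_mul, integral_const_mul] at key
  simp only [ne_eq, OfNat.ofNat_ne_zero, not_false_eq_true, zero_pow, mul_zero, neg_zero, sub_zero,
    Real.exp_zero, zero_sub] at key
  rw [eq_comm, one_div, inv_mul_eq_iff_eq_mul₀ (by positivity)]
  linarith

/-- Complete the square by the substitution `t = r a + B / r` with `r = √(2A)`. -/
theorem integral_exp_quadratic {A : ℝ} (hA : 0 < A) (B : ℝ) :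
    ∫ a in Set.Ioi (0 : ℝ), Real.exp (-(A * a ^ 2) - B * a) =
      Real.sqrt (2 * Real.pi) / Real.sqrt (2 * A) * Real.exp (B ^ 2 / (4 * A)) *
        gaussQ (B / Real.sqrt (2 * A)) := by
  have hr : 0 < Real.sqrt (2 * A) := Real.sqrt_pos.mpr (by linarith)
  have hr2 : Real.sqrt (2 * A) ^ 2 = 2 * A := Real.sq_sqrt (by linarith)
  set r := Real.sqrt (2 * A)
  set g : ℝ → ℝ := (Set.Ioi (B / r)).indicator fun t => Real.exp (-(t ^ 2 / 2))
  have hA2 : A = r ^ 2 / 2 := by linarith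
  have h1 : ∀ a, (Set.Ioi (0 : ℝ)).indicator (fun a => Real.exp (-(A * a ^ 2) - B * a)) a =
      Real.exp (B ^ 2 / (4 * A)) * g (r * a + B / r) := by
    intro a
    simp only [g, Set.indicator, Set.mem_Ioi]
    have hiff : B / r < r * a + B / r ↔ 0 < a := by
      rw [lt_add_iff_pos_left]
      exact mul_pos_iff_of_pos_left hr
    simp only [hiff]
    split_ifs with ha
    · rw [← Real.exp_add]
      congr 1
      rw [hA2]
      field_simp
      ring
    · simp
  rw [← integral_indicator measurableSet_Ioi, funext h1, integral_const_mul,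
    Measure.integral_comp_mul_left (fun x => g (x + B / r)) r, integral_add_right_eq_self g,
    integral_indicator measurableSet_Ioi, abs_of_pos (inv_pos.mpr hr), gaussQ]
  have hpi : Real.sqrt (2 * Real.pi) ≠ 0 := (Real.sqrt_pos.mpr (by positivity)).ne'
  simp only [smul_eq_mul]
  field_simp

theorem coefA_pos (ρ v : ℝ) {σ : ℝ} (hσ : 0 < σ) : 0 < coefA ρ v σ := by
  unfold coefA; positivity

theorem Lam_eq_integral (ρ v : ℝ) {σ : ℝ} (hσ : 0 < σ) (s θ : ℝ) :
    Lam ρ v σ s θ = 1 / σ ^ 2 * ∫ a in Set.Ioi (0 : ℝ),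
      a * Real.exp (-(coefA ρ v σ * a ^ 2) - coefB σ s θ * a) := by
  have hA := coefA_pos ρ v hσ
  rw [integral_mul_exp_quadratic hA, integral_exp_quadratic hA, Lam]
  field_simp

theorem continuous_besselI0 : Continuous besselI0 := by
  unfold besselI0
  refine continuous_const.mul
    (intervalIntegral.continuous_parametric_intervalIntegral_of_continuous' ?_ _ _)
  unfold Function.uncurry
  fun_prop

theorem besselI0_eq (x : ℝ) :
    besselI0 x = 1 / Real.pi * ∫ θ in (0 : ℝ)..Real.pi, Real.exp (x * Real.cos θ) := by
  have hi : ∀ a b, IntervalIntegrable (fun θ => Real.exp (x * Real.cos θ)) volume a b :=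
    fun a b => Continuous.intervalIntegrable (by fun_prop) a b
  have h := intervalIntegral.integral_comp_neg (a := 0) (b := Real.pi)
    (fun θ => Real.exp (x * Real.cos θ))
  simp only [Real.cos_neg, neg_zero] at h
  rw [besselI0, ← intervalIntegral.integral_add_adjacent_intervals (hi _ 0) (hi 0 _), ← h]
  field_simp
  ring

theorem continuous_ricianPDF (s σ : ℝ) : Continuous (ricianPDF s σ) := by
  unfold ricianPDF
  have := continuous_besselI0
  fun_prop

/-- The hypothesis for Fubini in `lintegral_rician`: replacing `B_θ` by its lower bound `-|s| / σ²`
dominates the kernel uniformly in `θ`. -/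
theorem integrable_rician_kernel {A : ℝ} (hA : 0 < A) (σ s : ℝ) :
    Integrable (Function.uncurry fun (θ a : ℝ) =>
      a * Real.exp (-(A * a ^ 2) - coefB σ s θ * a))
      ((volume.restrict (Set.uIoc 0 Real.pi)).prod (volume.restrict (Set.Ioi 0))) := by
  have : IsFiniteMeasure (volume.restrict (Set.uIoc 0 Real.pi)) :=
    ⟨by rw [Measure.restrict_apply_univ, Set.uIoc]; exact measure_Ioc_lt_top⟩
  have hb : Integrable (fun z : ℝ × ℝ => (1 : ℝ) *
      (z.2 * Real.exp (-(A * z.2 ^ 2) - (-(|s| / σ ^ 2)) * z.2)))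
      ((volume.restrict (Set.uIoc 0 Real.pi)).prod (volume.restrict (Set.Ioi 0))) :=
    Integrable.mul_prod (f := fun _ => (1 : ℝ)) (integrable_const _)
      (integrableOn_mul_exp_quadratic hA _)
  refine hb.mono' ?_ ?_
  · refine Continuous.aestronglyMeasurable ?_
    unfold Function.uncurry coefB
    fun_prop
  · rw [Measure.prod_restrict]
    refine (ae_restrict_iff' (measurableSet_uIoc.prod measurableSet_Ioi)).mpr
      (Filter.Eventually.of_forall fun z hz => ?_)
    have ha : 0 < z.2 := hz.2
    simp only [Function.uncurry]
    rw [Real.norm_of_nonneg (by positivity), one_mul]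
    have : -coefB σ s z.1 ≤ |s| / σ ^ 2 := by
      unfold coefB
      rw [neg_neg]
      gcongr
      calc s * Real.cos z.1 ≤ |s * Real.cos z.1| := le_abs_self _
        _ = |s| * |Real.cos z.1| := abs_mul _ _
        _ ≤ |s| * 1 := by gcongr; exact Real.abs_cos_le_one _
        _ = |s| := mul_one _
    gcongr
    linarith

/-- The Laplace transform of the squared Rician envelope is `D̃`. -/
theorem lintegral_rician (ρ v : ℝ) {σ : ℝ} (hσ : 0 < σ) (s : ℝ) :
    ∫⁻ a, ENNReal.ofReal (Real.exp (-(1 / 2 * (Real.sqrt (2 * ρ) + v) ^ 2 * a ^ 2)))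
      ∂(ricianMeasure s σ) = ENNReal.ofReal (Dtilde ρ v σ s) := by
  have hA := coefA_pos ρ v hσ
  have hK := integrable_rician_kernel hA σ s
  set A := coefA ρ v σ with hAdef
  set K : ℝ → ℝ → ℝ := fun θ a => a * Real.exp (-(A * a ^ 2) - coefB σ s θ * a) with hKdef
  set C := 1 / Real.pi * Real.exp (-(s ^ 2 / (2 * σ ^ 2))) * (1 / σ ^ 2) with hCdef
  have hC : 0 ≤ C := by have := Real.pi_pos; positivity
  -- The tilt and the Gaussian part of the density combine to the coefficient `A` of `a²`, while the
  -- exponent in the Bessel integral is `-B_θ a`.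
  have hpdf : ∀ a, ricianPDF s σ a *
      Real.exp (-(1 / 2 * (Real.sqrt (2 * ρ) + v) ^ 2 * a ^ 2)) =
      C * ∫ θ in (0 : ℝ)..Real.pi, K θ a := by
    intro a
    rw [ricianPDF, besselI0_eq]
    have e : ∀ θ, K θ a = (a * Real.exp (-(A * a ^ 2))) *
        Real.exp (a * s / σ ^ 2 * Real.cos θ) := fun θ => by
      simp only [hKdef]
      rw [mul_assoc, ← Real.exp_add, coefB]
      congr 2
      ring
    rw [intervalIntegral.integral_congr fun θ _ => e θ, intervalIntegral.integral_const_mul]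
    have e2 : Real.exp (-((a ^ 2 + s ^ 2) / (2 * σ ^ 2))) *
        Real.exp (-(1 / 2 * (Real.sqrt (2 * ρ) + v) ^ 2 * a ^ 2)) =
        Real.exp (-(s ^ 2 / (2 * σ ^ 2))) * Real.exp (-(A * a ^ 2)) := by
      rw [← Real.exp_add, ← Real.exp_add, hAdef, coefA]
      congr 1
      ring
    rw [hCdef]
    linear_combination (a / σ ^ 2 * (1 / Real.pi *
      ∫ θ in (0 : ℝ)..Real.pi, Real.exp (a * s / σ ^ 2 * Real.cos θ))) * e2
  have hint : Integrable (fun a => C * ∫ θ in (0 : ℝ)..Real.pi, K θ a)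
      (volume.restrict (Set.Ioi 0)) := by
    refine Integrable.const_mul ?_ C
    refine hK.integral_prod_right.congr (Filter.Eventually.of_forall fun a => ?_)
    simp only [Function.uncurry, Set.uIoc_of_le Real.pi_pos.le,
      intervalIntegral.integral_of_le Real.pi_pos.le, hKdef]
  have hm : Measurable fun a => ENNReal.ofReal (ricianPDF s σ a) :=
    (continuous_ricianPDF s σ).measurable.ennreal_ofReal
  rw [ricianMeasure, lintegral_withDensity_eq_lintegral_mul _ hm (by fun_prop),
    setLIntegral_congr Ioi_ae_eq_Ici.symm]
  have hstep : ∫⁻ a in Set.Ioi (0 : ℝ), ((fun a => ENNReal.ofReal (ricianPDF s σ a)) *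
      fun a => ENNReal.ofReal (Real.exp (-(1 / 2 * (Real.sqrt (2 * ρ) + v) ^ 2 * a ^ 2)))) a =
      ∫⁻ a in Set.Ioi (0 : ℝ), ENNReal.ofReal (C * ∫ θ in (0 : ℝ)..Real.pi, K θ a) := by
    refine lintegral_congr fun a => ?_
    rw [Pi.mul_apply, ← ENNReal.ofReal_mul' (Real.exp_pos _).le, hpdf]
  rw [hstep, ← ofReal_integral_eq_lintegral_ofReal hint]
  · congr 1
    rw [integral_const_mul, ← MeasureTheory.intervalIntegral_integral_swap hK, Dtilde,
      intervalIntegral.integral_congr fun θ _ => Lam_eq_integral ρ v hσ s θ,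
      intervalIntegral.integral_const_mul, hCdef]
    ring
  · refine (ae_restrict_iff' measurableSet_Ioi).mpr (Filter.Eventually.of_forall fun a ha => ?_)
    have ha : 0 < a := ha
    refine mul_nonneg hC (intervalIntegral.integral_nonneg Real.pi_pos.le fun θ _ => ?_)
    simp only [hKdef]
    positivity

theorem lintegral_exp_gaussian (w : ℝ≥0) (b c : ℝ) :
    ∫⁻ n, ENNReal.ofReal (Real.exp (b * n + c)) ∂(gaussianReal 0 w) =
      ENNReal.ofReal (Real.exp (w * b ^ 2 / 2 + c)) := by
  have h : ∀ n : ℝ, Real.exp (b * n + c) = Real.exp c * Real.exp (b * n) := fun n => by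
    rw [Real.exp_add, mul_comm]
  simp only [h]
  rw [← ofReal_integral_eq_lintegral_ofReal ((integrable_exp_mul_gaussianReal b).const_mul _)
    (Filter.Eventually.of_forall fun n => by positivity), integral_const_mul]
  have := congrFun (mgf_fun_id_gaussianReal (μ := 0) (v := w)) b
  rw [mgf] at this
  rw [this, ← Real.exp_add]
  congr 2
  ring

/-- The tilted likelihood ratio of one received sample, with envelope `a` and noise `n`: the
factor of the Chernoff bound. -/
noncomputable def tilt (κ N0 x a n : ℝ) : ℝ := Real.exp (2 * κ / N0 * (-(κ * a ^ 2) - a * x * n))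

theorem tilt_nonneg (κ N0 x a n : ℝ) : 0 ≤ tilt κ N0 x a n := (Real.exp_pos _).le

/-- For fixed `a`, the noise average of `exp(λ(-κa² - axn))` has exponent `-λκa² + λ²a²N₀/4`. The
value `λ = 2κ/N₀` minimises it and leaves `-κ²a²/N₀`, which the Rician average turns into `D̃`. -/
theorem lintegral_tilt {Ec N0 c v : ℝ} (hN0 : 0 < N0) (hc : c = v * Real.sqrt (N0 / 2))
    {σ : ℝ} (hσ : 0 < σ) (s : ℝ) {x : ℝ} (hx : x ^ 2 = 1) :
    ∫⁻ z, ENNReal.ofReal (tilt (Real.sqrt Ec + c) N0 x z.1 z.2)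
      ∂((ricianMeasure s σ).prod (gaussianReal 0 (N0 / 2).toNNReal)) =
      ENNReal.ofReal (Dtilde (Ec / N0) v σ s) := by
  set κ := Real.sqrt Ec + c with hκ
  rw [lintegral_prod _ (by unfold tilt; fun_prop), ← lintegral_rician _ _ hσ]
  refine lintegral_congr fun a => ?_
  have e : ∀ n, tilt κ N0 x a n =
      Real.exp ((-(2 * κ / N0 * (a * x))) * n + (-(2 * κ / N0 * (κ * a ^ 2)))) := fun n => by
    unfold tilt; congr 1; ring
  simp only [e]
  rw [lintegral_exp_gaussian, Real.coe_toNNReal _ (by positivity)]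
  congr 2
  have hr : 0 < Real.sqrt (N0 / 2) := Real.sqrt_pos.mpr (by positivity)
  have hr2 : Real.sqrt (N0 / 2) ^ 2 = N0 / 2 := Real.sq_sqrt (by positivity)
  have h2 : Real.sqrt (2 * (Ec / N0)) = Real.sqrt Ec / Real.sqrt (N0 / 2) := by
    rw [← Real.sqrt_div' _ (by positivity)]
    congr 1
    field_simp
  have h3 : κ = (Real.sqrt (2 * (Ec / N0)) + v) * Real.sqrt (N0 / 2) := by
    rw [h2, hκ, hc]; field_simp
  have h4 : κ ^ 2 = (Real.sqrt (2 * (Ec / N0)) + v) ^ 2 * (N0 / 2) := by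
    rw [h3, mul_pow, hr2]
  have h5 : N0 / 2 * (-(2 * κ / N0 * (a * x))) ^ 2 / 2 + -(2 * κ / N0 * (κ * a ^ 2)) =
      κ ^ 2 * a ^ 2 / N0 * (x ^ 2 - 2) := by
    field_simp
    ring
  rw [h5, hx, h4]
  field_simp
  ring

/-- The product formula for functions of the pairs `(X (inl k), X (inr k))` of independent random
variables. -/
theorem lintegral_prod_pairs {Ω ι : Type*} [MeasurableSpace Ω] {P : Measure Ω}
    [IsProbabilityMeasure P] [DecidableEq ι] {X : ι ⊕ ι → Ω → ℝ} (hX : iIndepFun X P)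
    (hm : ∀ z, AEMeasurable (X z) P) {f : ι → ℝ × ℝ → ℝ≥0∞} (hf : ∀ k, Measurable (f k))
    (S : Finset ι) :
    ∫⁻ ω, ∏ k ∈ S, f k (X (Sum.inl k) ω, X (Sum.inr k) ω) ∂P =
      ∏ k ∈ S, ∫⁻ ω, f k (X (Sum.inl k) ω, X (Sum.inr k) ω) ∂P := by
  induction S using Finset.induction_on with
  | empty => simp
  | insert a S ha ih =>
    simp only [Finset.prod_insert ha]
    rw [← ih]
    -- The new factor and the remaining product are functions of disjoint sets of variables, hence
    -- independent.
    let U : Finset (ι ⊕ ι) := {Sum.inl a, Sum.inr a}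
    let T : Finset (ι ⊕ ι) := S.disjSum S
    have hUT : Disjoint U T := by
      rw [Finset.disjoint_left]
      intro z hz hzT
      simp only [U, Finset.mem_insert, Finset.mem_singleton] at hz
      rcases hz with rfl | rfl <;> simp [T] at hzT <;> exact ha hzT
    have hind := hX.indepFun_finset₀ U T hUT hm
    let g : (U → ℝ) → ℝ≥0∞ := fun w =>
      f a (w ⟨Sum.inl a, by simp [U]⟩, w ⟨Sum.inr a, by simp [U]⟩)
    let h : (T → ℝ) → ℝ≥0∞ := fun w => ∏ k ∈ S.attach,
      f k (w ⟨Sum.inl k, by simp [T]⟩, w ⟨Sum.inr k, by simp [T]⟩)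
    have hg : Measurable g := (hf a).comp (by fun_prop)
    have hh : Measurable h := Finset.measurable_prod _ fun k _ => (hf k).comp (by fun_prop)
    have hgh := hind.comp hg hh
    have e : ∀ ω, ∏ k ∈ S, f k (X (Sum.inl k) ω, X (Sum.inr k) ω) =
        (h ∘ fun ω (i : T) => X i ω) ω := fun ω => by
      simp only [h, Function.comp]
      exact (Finset.prod_attach S fun k => f k (X (Sum.inl k) ω, X (Sum.inr k) ω)).symm
    simp only [e]
    exact lintegral_mul_eq_lintegral_mul_lintegral_of_indepFun''
      (hg.comp_aemeasurable (aemeasurable_pi_lambda _ fun i => hm i))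
      (hh.comp_aemeasurable (aemeasurable_pi_lambda _ fun i => hm i)) hgh

end Channel

/-! ### Chernoff bound for one competitor, and summation over detours -/

section Bounds

variable {kc nc m H M : ℕ} (G : ConvCode kc nc m)

/-- The positions up to level `t` in which the code words of `p` and `q` differ. -/
def differing (M t : ℕ) (p q : TPath kc) : Finset (Fin M × Fin nc) :=
  Finset.univ.filter fun k => (k.1 : ℕ) < t ∧ codeBits G q k.1 k.2 ≠ codeBits G p k.1 k.2

theorem symbol_eq_iff {p q : TPath kc} {j : ℕ} {i : Fin nc} :
    symbol G q j i = symbol G p j i ↔ codeBits G q j i = codeBits G p j i := by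
  unfold symbol
  have two : ∀ a b : ZMod 2, ((if a = 0 then (1 : ℝ) else -1) = if b = 0 then 1 else -1) ↔
      a = b := by
    have h01 : ∀ a : ZMod 2, a = 0 ∨ a = 1 := by decide
    intro a b
    rcases h01 a with rfl | rfl <;> rcases h01 b with rfl | rfl <;> norm_num
  exact two _ _

theorem symbol_sq (p : TPath kc) (j : ℕ) (i : Fin nc) : symbol G p j i ^ 2 = 1 := by
  unfold symbol
  split_ifs <;> norm_num

theorem symbol_eq_neg {p q : TPath kc} {j : ℕ} {i : Fin nc}
    (h : symbol G q j i ≠ symbol G p j i) : symbol G q j i = -symbol G p j i :=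
  (sq_eq_sq_iff_eq_or_eq_neg.mp ((symbol_sq G q j i).trans (symbol_sq G p j i).symm)).resolve_left h

theorem sum_filter_lt_eq (t : ℕ) (f : Fin M → Fin nc → ℝ) :
    ∑ j ∈ Finset.univ.filter (fun j : Fin M => (j : ℕ) < t), ∑ i, f j i =
      ∑ k : Fin M × Fin nc, if (k.1 : ℕ) < t then f k.1 k.2 else 0 := by
  rw [Finset.sum_filter, Fintype.sum_prod_type]
  refine Finset.sum_congr rfl fun j _ => ?_
  split_ifs <;> simp

/-- Positions with equal code bits drop out. At the others the symbol of `q` is `-x`, so the two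
sides of the beating condition differ by `2(-κα² - αxν)`. The sign of `κ` is needed to multiply by
`2κ/N₀`. -/
theorem one_le_prod_tilt {c Ec N0 : ℝ} (hN0 : 0 < N0) (hκ : 0 ≤ Real.sqrt Ec + c)
    {α ν : Fin M → Fin nc → ℝ} {p q : TPath kc} {t : ℕ}
    (h : Beats G c α (received G Ec p α ν) t q p) :
    1 ≤ ∏ k ∈ differing G M t p q,
      tilt (Real.sqrt Ec + c) N0 (symbol G p k.1 k.2) (α k.1 k.2) (ν k.1 k.2) := by
  unfold tilt
  rw [← Real.exp_sum, Real.one_le_exp_iff, ← Finset.mul_sum]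
  refine mul_nonneg (by positivity) ?_
  unfold Beats at h
  rw [sum_filter_lt_eq, sum_filter_lt_eq, Finset.mul_sum, ← sub_nonneg,
    ← Finset.sum_sub_distrib] at h
  have e : ∀ k : Fin M × Fin nc,
      (if (k.1 : ℕ) < t then α k.1 k.2 * (symbol G q k.1 k.2 - symbol G p k.1 k.2) *
        received G Ec p α ν k.1 k.2 else 0) -
      c * (if (k.1 : ℕ) < t then |symbol G p k.1 k.2 - symbol G q k.1 k.2| * α k.1 k.2 ^ 2 else 0)
      = 2 * if (k.1 : ℕ) < t ∧ codeBits G q k.1 k.2 ≠ codeBits G p k.1 k.2 then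
        (-((Real.sqrt Ec + c) * α k.1 k.2 ^ 2) - α k.1 k.2 * symbol G p k.1 k.2 * ν k.1 k.2)
        else 0 := by
    intro k
    by_cases h1 : (k.1 : ℕ) < t
    · by_cases h2 : codeBits G q k.1 k.2 = codeBits G p k.1 k.2
      · have := (symbol_eq_iff G).mpr h2
        simp [h2, this]
      · have h3 := symbol_eq_neg G (mt (symbol_eq_iff G).mp h2)
        have h4 : |symbol G p k.1 k.2 - -symbol G p k.1 k.2| = 2 := by
          unfold symbol
          split_ifs <;> norm_num
        rw [if_pos h1, if_pos h1, if_pos ⟨h1, h2⟩, h3, h4, received]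
        linear_combination (-2 * Real.sqrt Ec * α k.1 k.2 ^ 2) * symbol_sq G p k.1 k.2
    · simp [h1]
  rw [Finset.sum_congr rfl fun k _ => e k, ← Finset.mul_sum, ← Finset.sum_filter] at h
  unfold differing
  linarith

/-- The differing positions are the nonzero code bits of `d`, delayed by `t - L`; `t ≤ M` ensures
that none falls outside the received block. -/
theorem card_differing {p d : TPath kc} {t L : ℕ} (hL : L ≤ t) (ht : t ≤ M) :
    (differing G M t p (perturb p (t - L) d)).card = outWeight G (L, d) := by
  have e : ∀ k : Fin M × Fin nc, codeBits G (perturb p (t - L) d) k.1 k.2 ≠ codeBits G p k.1 k.2 ↔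
      (t - L ≤ k.1 ∧ codeBits G d (k.1 - (t - L)) k.2 ≠ 0) := fun k => by
    rw [codeBits_perturb]
    split_ifs with h <;> simp [h]
  have h1 : ∀ j : ℕ, ∑ i : Fin nc,
      (if j < t ∧ t - L ≤ j ∧ codeBits G d (j - (t - L)) i ≠ 0 then 1 else 0) =
      if j ∈ Finset.Ico (t - L) t then hammingNorm (codeBits G d (j - (t - L))) else 0 := by
    intro j
    simp only [Finset.mem_Ico]
    split_ifs with h
    · simp only [h, true_and]
      rw [hammingNorm, Finset.card_filter]
    · refine Finset.sum_eq_zero fun i _ => if_neg fun h2 => h ⟨h2.2.1, h2.1⟩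
  unfold differing outWeight
  simp only [e]
  rw [Finset.card_filter, Fintype.sum_prod_type]
  simp only [h1]
  rw [Fin.sum_univ_eq_sum_range (fun j => if j ∈ Finset.Ico (t - L) t then
    hammingNorm (codeBits G d (j - (t - L))) else 0), ← Finset.sum_filter,
    Finset.filter_mem_eq_inter, Finset.inter_eq_right.mpr (fun j hj => by
      simp only [Finset.mem_Ico, Finset.mem_range] at hj ⊢; omega),
    Finset.sum_Ico_eq_sum_range, show t - (t - L) = L by omega]
  exact Finset.sum_congr rfl fun j _ => by rw [Nat.add_sub_cancel_left]

variable {Ω : Type*}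

/-- The standing assumptions on the channel, with margin coefficient `c = v √(N₀ / 2)`. -/
structure Channel [MeasurableSpace Ω] (P : Measure Ω) (Ec N0 s σ v c : ℝ) (α ν : Fin M → Fin nc → Ω → ℝ) : Prop where
  noise_pos : 0 < N0
  scale_pos : 0 < σ
  margin_eq : c = v * Real.sqrt (N0 / 2)
  margin_ge : 0 ≤ Real.sqrt Ec + c
  law_fading : ∀ j i, HasLaw (α j i) (ricianMeasure s σ) P
  law_noise : ∀ j i, HasLaw (ν j i) (gaussianReal 0 (N0 / 2).toNNReal) P
  indep : iIndepFun (fun z : (Fin M × Fin nc) ⊕ (Fin M × Fin nc) =>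
    Sum.elim (fun a => α a.1 a.2) (fun a => ν a.1 a.2) z) P

/-- The Chernoff bound for the indicator of the event that `q` beats the transmitted path `p`. -/
noncomputable def chernoff (c Ec N0 : ℝ) (α ν : Fin M → Fin nc → Ω → ℝ) (p q : TPath kc) (t : ℕ)
    (ω : Ω) : ℝ≥0∞ :=
  ∏ k ∈ differing G M t p q, ENNReal.ofReal
    (tilt (Real.sqrt Ec + c) N0 (symbol G p k.1 k.2) (α k.1 k.2 ω) (ν k.1 k.2 ω))

namespace Channel

variable {G} [MeasurableSpace Ω] {P : Measure Ω} {Ec N0 s σ v c : ℝ}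
  {α ν : Fin M → Fin nc → Ω → ℝ}

theorem one_le_chernoff (hch : Channel P Ec N0 s σ v c α ν)
    {p q : TPath kc} {t : ℕ} {ω : Ω}
    (h : Beats G c (fun j i => α j i ω)
      (received G Ec p (fun j i => α j i ω) (fun j i => ν j i ω)) t q p) :
    1 ≤ chernoff G c Ec N0 α ν p q t ω := by
  unfold chernoff
  have h1 := ENNReal.one_le_ofReal.mpr (one_le_prod_tilt G hch.noise_pos hch.margin_ge h)
  rwa [ENNReal.ofReal_prod_of_nonneg fun k _ => tilt_nonneg _ _ _ _ _] at h1

theorem aemeasurable_chernoff (hch : Channel P Ec N0 s σ v c α ν)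
    (p q : TPath kc) (t : ℕ) :
    AEMeasurable (chernoff G c Ec N0 α ν p q t) P := by
  unfold chernoff
  refine Finset.aemeasurable_fun_prod _ fun k _ => ?_
  have h1 := (hch.law_fading k.1 k.2).aemeasurable
  have h2 := (hch.law_noise k.1 k.2).aemeasurable
  unfold tilt
  fun_prop

theorem lintegral_chernoff [IsProbabilityMeasure P]
    (hch : Channel P Ec N0 s σ v c α ν) (p q : TPath kc) (t : ℕ) :
    ∫⁻ ω, chernoff G c Ec N0 α ν p q t ω ∂P =
      ENNReal.ofReal (Dtilde (Ec / N0) v σ s) ^ (differing G M t p q).card := by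
  have hm : ∀ z : (Fin M × Fin nc) ⊕ (Fin M × Fin nc), AEMeasurable
      (Sum.elim (fun a => α a.1 a.2) (fun a => ν a.1 a.2) z : Ω → ℝ) P := by
    rintro (k | k)
    · exact (hch.law_fading k.1 k.2).aemeasurable
    · exact (hch.law_noise k.1 k.2).aemeasurable
  have hf : ∀ k : Fin M × Fin nc, Measurable fun z : ℝ × ℝ =>
      ENNReal.ofReal (tilt (Real.sqrt Ec + c) N0 (symbol G p k.1 k.2) z.1 z.2) := fun k => by
    unfold tilt
    fun_prop
  have h := lintegral_prod_pairs hch.indep hm hf (differing G M t p q)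
  simp only [Sum.elim_inl, Sum.elim_inr] at h
  unfold chernoff
  rw [h, Finset.prod_congr rfl fun k _ => ?_, Finset.prod_const]
  have hlaw := (hch.indep.indepFun (show Sum.inl k ≠ Sum.inr k by simp)).hasLaw_prod
    (hch.law_fading k.1 k.2) (hch.law_noise k.1 k.2)
  rw [← lintegral_tilt hch.noise_pos hch.margin_eq hch.scale_pos s (symbol_sq G p k.1 k.2)]
  exact hlaw.lintegral_comp (hf k).aemeasurable

theorem measure_beats_le [IsProbabilityMeasure P]
    (hch : Channel P Ec N0 s σ v c α ν) (p q : TPath kc) (t : ℕ) :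
    P {ω | Beats G c (fun j i => α j i ω)
      (received G Ec p (fun j i => α j i ω) (fun j i => ν j i ω)) t q p} ≤
      ENNReal.ofReal (Dtilde (Ec / N0) v σ s) ^ (differing G M t p q).card := by
  rw [← hch.lintegral_chernoff p q t]
  -- Markov's inequality at threshold `1`.
  refine (measure_mono fun ω hω => ?_).trans
    ((mul_meas_ge_le_lintegral₀ (hch.aemeasurable_chernoff p q t) 1).trans' (one_mul _).ge)
  exact hch.one_le_chernoff hω

/-- The union bound over the detours that end at level `t`. -/
theorem measure_beaten_le [IsProbabilityMeasure P]
    (hch : Channel P Ec N0 s σ v c α ν) (p : TPath kc) {t : ℕ} (ht : t ≤ M) :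
    P {ω | Beaten G c (fun j i => α j i ω)
      (received G Ec p (fun j i => α j i ω) (fun j i => ν j i ω)) p t} ≤
      transfer G (ENNReal.ofReal (Dtilde (Ec / N0) v σ s)) 1 := by
  set E : ZeroDetours kc m → Set Ω := fun d => {ω | d.1.1 ≤ t ∧ Beats G c (fun j i => α j i ω)
    (received G Ec p (fun j i => α j i ω) (fun j i => ν j i ω)) t
      (perturb p (t - d.1.1) d.1.2) p}
  calc _ ≤ P (⋃ d, E d) := measure_mono fun ω hω => by
        obtain ⟨d, hd, h⟩ := hω
        exact Set.mem_iUnion.mpr ⟨⟨d, hd⟩, h⟩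
    _ ≤ ∑' d, P (E d) := measure_iUnion_le _
    _ ≤ _ := by
      unfold transfer
      refine ENNReal.tsum_le_tsum fun d => ?_
      rw [one_pow, mul_one]
      by_cases hd : d.1.1 ≤ t
      · rw [← card_differing (p := p) G hd ht]
        exact (measure_mono fun ω h => h.2).trans (hch.measure_beats_le _ _ _)
      -- A detour longer than `t` cannot end at level `t`; its term in the series is simply added.
      · have : E d = ∅ := Set.eq_empty_of_forall_notMem fun ω h => hd h.1
        rw [this, measure_empty]
        exact zero_le

end Channel

/-- The contribution of a detour beginning at level `s` to the number of bit errors is bounded by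
the Chernoff bounds. -/
theorem bitErrors_le {c Ec N0 : ℝ} {α ν : Fin (H + m) → Fin nc → Ω → ℝ} {p : TPath kc}
    (hp : IsBlock H p) {ω : Ω}
    (hch : ∀ q t, Beats G c (fun j i => α j i ω)
      (received G Ec p (fun j i => α j i ω) (fun j i => ν j i ω)) t q p →
      1 ≤ chernoff G c Ec N0 α ν p q t ω) :
    (bitErrors G H c (fun j i => α j i ω)
      (received G Ec p (fun j i => α j i ω) (fun j i => ν j i ω)) p : ℝ≥0∞) ≤
    ∑ s ∈ Finset.range H, ∑' d : ZeroDetours kc m, if s + d.1.1 ≤ H + m then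
      (inWeight d.1 : ℝ≥0∞) * chernoff G c Ec N0 α ν p (perturb p s d.1.2) (s + d.1.1) ω
      else 0 := by
  classical
  set y := received G Ec p (fun j i => α j i ω) (fun j i => ν j i ω) with hy
  set q := decoded G H (fun j i => α j i ω) y with hq
  set g : ℕ → ZeroDetours kc m → ℝ≥0∞ := fun s d => if s + d.1.1 ≤ H + m then
      (inWeight d.1 : ℝ≥0∞) * chernoff G c Ec N0 α ν p (perturb p s d.1.2) (s + d.1.1) ω
      else 0 with hg
  set f : ℕ → ℕ → ℝ≥0∞ := fun t s => if s < t ∧ Detour m q p s t ∧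
      Beats G c (fun j i => α j i ω) y t (splice s p q) p then
      ((∑ j ∈ Finset.Ico s t, hammingDist (q j) (p j) : ℕ) : ℝ≥0∞) else 0 with hf
  have h1 : (bitErrors G H c (fun j i => α j i ω) y p : ℝ≥0∞) =
      ∑ t ∈ Finset.range (H + m + 1), ∑ s ∈ Finset.range H, f t s := by
    unfold bitErrors
    rw [Nat.cast_sum]
    refine Finset.sum_congr rfl fun t _ => ?_
    rw [Nat.cast_sum]
    -- No detour begins at a level `s ≥ H`, where both inputs are zero. The starting range can thus
    -- be made independent of `t`, which allows the sums to be exchanged.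
    have hzero : ∀ s, ¬ (s < H ∧ s < t) → f t s = 0 := fun s hs => by
      refine if_neg fun h => hs ⟨?_, h.1⟩
      by_contra hsH
      refine h.2.1.2.2.1 ?_
      rw [hp s (not_lt.mp hsH), hq, decoded_eq_zero G _ _ (not_lt.mp hsH)]
    have hl : ∑ s ∈ Finset.range t, f t s = ∑ s ∈ Finset.range (H + t), f t s :=
      Finset.sum_subset (fun s hs => by simp only [Finset.mem_range] at hs ⊢; omega)
        fun s _ hs => hzero s fun h => hs (Finset.mem_range.mpr h.2)
    have hr : ∑ s ∈ Finset.range H, f t s = ∑ s ∈ Finset.range (H + t), f t s :=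
      Finset.sum_subset (fun s hs => by simp only [Finset.mem_range] at hs ⊢; omega)
        fun s _ hs => hzero s fun h => hs (Finset.mem_range.mpr h.1)
    rw [hr, ← hl]
    refine Finset.sum_congr rfl fun s hs => ?_
    simp only [hf, Finset.mem_range.mp hs, true_and]
    split_ifs <;> simp_all
  rw [h1, Finset.sum_comm]
  refine Finset.sum_le_sum fun s _ => ?_
  have hle : ∀ t ∈ Finset.range (H + m + 1), f t s ≤
      if h : Detour m p q s t then g s ⟨segment p q s t, h.segment_mem⟩ else 0 := by
    intro t ht
    simp only [hf]
    by_cases hcond : s < t ∧ Detour m q p s t ∧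
      Beats G c (fun j i => α j i ω) y t (splice s p q) p
    · obtain ⟨hst, hd, hb⟩ := hcond
      rw [if_pos ⟨hst, hd, hb⟩, dif_pos hd.symm]
      have e : s + (segment p q s t).1 = t := by simp only [segment]; omega
      simp only [hg, e]
      rw [if_pos (by have := Finset.mem_range.mp ht; omega), inWeight_segment]
      refine le_mul_of_one_le_right' (hch _ _ ?_)
      exact beats_congr G (fun j hj => (perturb_segment hst hj).symm) (fun _ _ => rfl) hb
    · rw [if_neg hcond]
      exact zero_le
  refine (Finset.sum_le_sum hle).trans ?_
  rw [Finset.sum_dite, Finset.sum_const_zero, add_zero]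
  -- For a fixed start the length of the segment recovers `t`, so distinct ends give distinct zero
  -- detours and their sum is part of the full series.
  set φ : {t // t ∈ (Finset.range (H + m + 1)).filter fun t => Detour m p q s t} →
      ZeroDetours kc m := fun t =>
    ⟨segment p q s t, (Finset.mem_filter.mp t.2).2.segment_mem⟩
  have hφ : Function.Injective φ := by
    intro t t' h
    have h2 : t.1 - s = t'.1 - s := congrArg (fun d : ZeroDetours kc m => d.1.1) h
    have h3 := (Finset.mem_filter.mp t.2).2.1
    have h4 := (Finset.mem_filter.mp t'.2).2.1
    exact Subtype.ext (by omega)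
  calc _ = ∑ t ∈ Finset.attach _, g s (φ t) := rfl
    _ ≤ ∑' t, g s (φ t) := ENNReal.sum_le_tsum _
    _ ≤ ∑' d, g s d := ENNReal.tsum_comp_le_tsum_of_injective hφ _

end Bounds

/-! ### Bit error and block retransmission probabilities -/

section Measures

variable {kc nc m H : ℕ} {G : ConvCode kc nc m} {Ω : Type*} [MeasurableSpace Ω] {P : Measure Ω}
  [IsProbabilityMeasure P] {Ec N0 s σ u v c : ℝ} {α ν : Fin (H + m) → Fin nc → Ω → ℝ}

/-- Termwise expectation: each of the `H` starting levels contributes at most the whole derivative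
series at `N = 1`. -/
theorem Channel.lintegral_bitErrors_le (hch : Channel P Ec N0 s σ v c α ν) {p : TPath kc}
    (hp : IsBlock H p) :
    ∫⁻ ω, (bitErrors G H c (fun j i => α j i ω)
      (received G Ec p (fun j i => α j i ω) (fun j i => ν j i ω)) p : ℝ≥0∞) ∂P ≤
      H * transferDN G (ENNReal.ofReal (Dtilde (Ec / N0) v σ s)) 1 := by
  refine (lintegral_mono fun ω => bitErrors_le G hp fun q t => hch.one_le_chernoff).trans ?_
  have hm : ∀ (a : ℕ) (d : ZeroDetours kc m), AEMeasurable (fun ω =>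
      if a + d.1.1 ≤ H + m then (inWeight d.1 : ℝ≥0∞) *
        chernoff G c Ec N0 α ν p (perturb p a d.1.2) (a + d.1.1) ω else 0) P := fun a d => by
    split_ifs
    · exact (hch.aemeasurable_chernoff _ _ _).const_mul _
    · exact aemeasurable_const
  rw [lintegral_finsetSum' _ fun a _ => AEMeasurable.tsum fun d => hm a d]
  calc _ ≤ ∑ _a ∈ Finset.range H,
        transferDN G (ENNReal.ofReal (Dtilde (Ec / N0) v σ s)) 1 := by
        refine Finset.sum_le_sum fun a _ => ?_
        rw [lintegral_tsum fun d => hm a d]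
        refine ENNReal.tsum_le_tsum fun d => ?_
        rw [one_pow, mul_one, mul_comm]
        split_ifs with h
        · rw [lintegral_const_mul'' _ (hch.aemeasurable_chernoff _ _ _),
            hch.lintegral_chernoff,
            ← card_differing (p := p) (L := d.1.1) G (Nat.le_add_left d.1.1 a) h,
            Nat.add_sub_cancel]
        · simp
    _ = _ := by simp

theorem Channel.pb_le (hch : Channel P Ec N0 s σ v (margin G N0 u) α ν) (hkc : 0 < kc)
    {p : TPath kc} (hp : IsBlock H p) :
    Pb P G H Ec N0 u α ν p ≤ transferDN G (ENNReal.ofReal (Dtilde (Ec / N0) v σ s)) 1 := by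
  unfold Pb
  refine ENNReal.div_le_of_le_mul ((hch.lintegral_bitErrors_le hp).trans ?_)
  rw [mul_comm]
  gcongr
  -- The factor `1 / kc` of the bit error rate is given away here.
  exact Nat.le_mul_of_pos_right H hkc

theorem Channel.pxBlock_le (hch : Channel P Ec N0 s σ v (-margin G N0 u) α ν) (hkc : 0 < kc)
    (hc : 0 ≤ margin G N0 u) {p : TPath kc} (hp : IsBlock H p) :
    PxBlock P G H Ec N0 u α ν p ≤
      H * transfer G (ENNReal.ofReal (Dtilde (Ec / N0) v σ s)) 1 := by
  unfold PxBlock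
  calc _ ≤ P (⋃ k ∈ Finset.range H, {ω | Beaten G (-margin G N0 u) (fun j i => α j i ω)
        (received G Ec p (fun j i => α j i ω) (fun j i => ν j i ω)) p (m + k + 1)}) := by
        refine measure_mono fun ω hω => ?_
        obtain ⟨k, hk, hb⟩ := Retransmission.exists_beaten G _ _ hkc hc hp hω
        exact Set.mem_biUnion (Finset.mem_range.mpr hk) hb
    _ ≤ ∑ k ∈ Finset.range H, P _ := measure_biUnion_finset_le _ _
    _ ≤ ∑ _k ∈ Finset.range H, transfer G (ENNReal.ofReal (Dtilde (Ec / N0) v σ s)) 1 :=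
        Finset.sum_le_sum fun k hk =>
          hch.measure_beaten_le p (by have := Finset.mem_range.mp hk; omega)
    _ = _ := by simp

end Measures

end ConvARQ

/-! ### The performance bounds -/

theorem corollary1 {kc nc m H : ℕ} (hkc : 0 < kc) (hH : 0 < H)
    (G : ConvARQ.ConvCode kc nc m) (hdf : 0 < ConvARQ.freeDist G)
    {Ω : Type*} [MeasurableSpace Ω] (P : Measure Ω) [IsProbabilityMeasure P]
    (Ec Eb N0 s σ u : ℝ) (hEc : 0 < Ec) (hN0 : 0 < N0) (hs : 0 ≤ s) (hσ : 0 < σ) (hu : 0 ≤ u)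
    (hEb : Eb = (((H : ℝ) + m) / H) * (1 / ((kc : ℝ) / nc)) * Ec)
    (α ν : Fin (H + m) → Fin nc → Ω → ℝ)
    (hα : ∀ j i, HasLaw (α j i) (ConvARQ.ricianMeasure s σ) P)
    (hν : ∀ j i, HasLaw (ν j i) (gaussianReal 0 (N0 / 2).toNNReal) P)
    (hindep : iIndepFun
      (fun z : (Fin (H + m) × Fin nc) ⊕ (Fin (H + m) × Fin nc) =>
        Sum.elim (fun a => α a.1 a.2) (fun a => ν a.1 a.2) z) P)
    (p : ConvARQ.TPath kc) (hp : ConvARQ.IsBlock H p) :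
    (∀ t ≤ H + m, ConvARQ.Pe P G H Ec N0 u α ν p t ≤
      ConvARQ.transfer G
        (ENNReal.ofReal (ConvARQ.Dtilde (Ec / N0) (u / ConvARQ.freeDist G) σ s)) 1) ∧
    (u < ConvARQ.freeDist G * Real.sqrt ((2 * Eb / N0) * ((H : ℝ) / (H + m)) * ((kc : ℝ) / nc)) →
      (∀ t < H + m, ConvARQ.Px P G H Ec N0 u α ν p t ≤
        ConvARQ.transfer G
          (ENNReal.ofReal (ConvARQ.Dtilde (Ec / N0) (-u / ConvARQ.freeDist G) σ s)) 1) ∧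
      ConvARQ.PxBlock P G H Ec N0 u α ν p ≤
        H * ConvARQ.transfer G
          (ENNReal.ofReal (ConvARQ.Dtilde (Ec / N0) (-u / ConvARQ.freeDist G) σ s)) 1) ∧
    ConvARQ.Pb P G H Ec N0 u α ν p ≤
      ConvARQ.transferDN G
        (ENNReal.ofReal (ConvARQ.Dtilde (Ec / N0) (u / ConvARQ.freeDist G) σ s)) 1 := by
  have hdf' : (0 : ℝ) < ConvARQ.freeDist G := by exact_mod_cast hdf
  have hm0 : 0 ≤ ConvARQ.margin G N0 u := by unfold ConvARQ.margin; positivity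
  have hplus : ConvARQ.Channel P Ec N0 s σ (u / ConvARQ.freeDist G) (ConvARQ.margin G N0 u) α ν :=
    ⟨hN0, hσ, rfl, add_nonneg (Real.sqrt_nonneg _) hm0, hα, hν, hindep⟩
  refine ⟨fun t ht => ?_, fun hlt => ?_, hplus.pb_le hkc hp⟩
  · exact (measure_mono fun ω hω => ConvARQ.FirstError.beaten G _ _ hp hω).trans
      (hplus.measure_beaten_le p ht)
  -- Without output bits every detour has weight zero, against the positive free distance; hence the
  -- rate can be cancelled.
  · have hnc : nc ≠ 0 := by
      rintro rfl
      refine hdf.ne' (Nat.sInf_eq_zero.mpr ?_)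
      by_cases hne : (ConvARQ.outWeight G '' ConvARQ.ZeroDetours kc m).Nonempty
      · obtain ⟨_, d, hd, rfl⟩ := hne
        refine Or.inl ⟨d, hd, Finset.sum_eq_zero fun j _ => ?_⟩
        rw [hammingNorm_eq_zero]
        exact Subsingleton.elim _ _
      · exact Or.inr (Set.not_nonempty_iff_eq_empty.mp hne)
    have hEc2 : 2 * Eb / N0 * ((H : ℝ) / (H + m)) * ((kc : ℝ) / nc) = Ec / (N0 / 2) := by
      have h1 : (H : ℝ) ≠ 0 := by exact_mod_cast hH.ne'
      have h2 : (nc : ℝ) ≠ 0 := by exact_mod_cast hnc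
      have h3 : (kc : ℝ) ≠ 0 := by exact_mod_cast hkc.ne'
      have h4 : (H : ℝ) + m ≠ 0 := by positivity
      rw [hEb]
      field_simp
    have hr : 0 < Real.sqrt (N0 / 2) := Real.sqrt_pos.mpr (by positivity)
    rw [hEc2, Real.sqrt_div' _ (by positivity)] at hlt
    -- The bound on `u` amounts to `u / d_f < √(2Ec/N₀)`; this keeps the Chernoff parameter
    -- nonnegative for the margin `-c`.
    have hle : ConvARQ.margin G N0 u ≤ Real.sqrt Ec := by
      unfold ConvARQ.margin
      rw [div_mul_eq_mul_div, div_le_iff₀ hdf']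
      rw [mul_div_assoc', lt_div_iff₀ hr] at hlt
      linarith
    have hminus : ConvARQ.Channel P Ec N0 s σ (-u / ConvARQ.freeDist G)
        (-ConvARQ.margin G N0 u) α ν :=
      ⟨hN0, hσ, by unfold ConvARQ.margin; ring, by linarith, hα, hν, hindep⟩
    refine ⟨fun t ht => ?_, hminus.pxBlock_le hkc hm0 hp⟩
    exact (measure_mono fun ω hω => ConvARQ.FlagX.beaten G _ _ hkc hm0 hp ht hω).trans
      (hminus.measure_beaten_le p ht)
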